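/- Let $\mathbb N=\{1,2,\dots\}$. A set $V\subseteq\mathbb N^3$ is a positive monotone set if $z\in V$, $y\in\mathbb N^3$ and $y^{(a)}\le z^{(a)}$ for $a=1,2,3$ imply $y\in V$. Let $V^-\subseteq V^+$ be positive monotone sets such that $\Lambda:=V^+\setminus V^-$ is finite. Consider the following continuous-time Markov chain on the set of positive monotone sets $V$ with $V^-\subseteq V\subseteq V^+$. Each $z\in\Lambda$ carries an independent Poisson clock of rate one. When the clock of $z$ rings, if both $V\setminus\{z\}$ and $V\cup\{z\}$ are positive monotone sets, the current state $V$ is replaced by one of these two sets, each with probability $1/2$; otherwise $V$ is kept unchanged. Let $\nu_t^{V_0}$ be the law at time $t$ of the chain started from $V_0$, let $\rho$ be the uniform probability measure on the state space (which is the invariant measure), and let $$T_{\rm mix}:=\inf\Bigl\{t>0:\ \sup_{V_0}\|\nu_t^{V_0}-\rho\|\le \tfrac1{2e}\Bigr\},$$ where $\|\mu-\nu\|=\frac12\sum_V|\mu(V)-\nu(V)|$ is the total variation distance. Put $$D:=\max_{y,z\in\Lambda}\bigl|(z^{(1)},z^{(2)})-(y^{(1)},y^{(2)})\bigr|\quad\text{(Euclidean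 distance in }\mathbb R^2),$$ $$H:=\max\bigl\{|z^{(3)}-y^{(3)}|:\ y,z\in\Lambda,\ y^{(1)}=z^{(1)},\ y^{(2)}=z^{(2)}\bigr\}$$ (both are $0$ if $\Lambda=\emptyset$). There is a universal constant $C>0$ such that, for all such $V^\pm$ with $H\le D$, $$T_{\rm mix}\le C\,\bar H^2\,\bar D^2\,(\log\bar D)^2,\qquad \bar H:=\max(H,1),\quad \bar D:=\max(D,2).$$ In particular $T_{\rm mix}\le C H^2D^2(\log D)^2$ whenever $H\ge1$ and $D\ge2$. -/

import Mathlib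

open scoped ENNReal

/-- Points of `ℕ³`, where `ℕ = {1, 2, …}`. The coordinates are `z 0`, `z 1`, `z 2` and the order is
the coordinatewise one. -/
abbrev Point : Type := Fin 3 → ℕ+

/-- Positive monotone sets: subsets of `ℕ³` that contain, with a point `z`, every point `y ≤ z`.
They are ordered by inclusion. -/
abbrev PositiveMonotoneSet : Type := LowerSet Point

/-- The region `Λ = V⁺ ∖ V⁻`. -/
def region (Vm Vp : PositiveMonotoneSet) : Set Point := (Vp : Set Point) \ (Vm : Set Point)

/-- Euclidean distance between the horizontal projections of two points. -/
noncomputable def horizontalDist (z y : Point) : ℝ :=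
  Real.sqrt (((z 0 : ℝ) - (y 0 : ℝ)) ^ 2 + ((z 1 : ℝ) - (y 1 : ℝ)) ^ 2)

/-- The largest horizontal distance between two points of `Λ` (a maximum when `Λ` is finite and
nonempty, and `0` when `Λ` is empty). -/
noncomputable def horizontalDiameter (Λ : Set Point) : ℝ :=
  sSup {r : ℝ | ∃ z ∈ Λ, ∃ y ∈ Λ, r = horizontalDist z y}

/-- The largest difference of heights of two points of `Λ` in a common vertical column (a maximum
when `Λ` is finite and nonempty, and `0` when `Λ` is empty). -/
noncomputable def verticalThickness (Λ : Set Point) : ℝ :=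
  sSup {r : ℝ | ∃ z ∈ Λ, ∃ y ∈ Λ, y 0 = z 0 ∧ y 1 = z 1 ∧ r = |(z 2 : ℝ) - (y 2 : ℝ)|}

/-- The state space: positive monotone sets `V` with `V⁻ ⊆ V ⊆ V⁺`. -/
abbrev State (Vm Vp : PositiveMonotoneSet) : Type :=
  {V : PositiveMonotoneSet // Vm ≤ V ∧ V ≤ Vp}

theorem finite_state (Vm Vp : PositiveMonotoneSet) [Finite (region Vm Vp)] :
    Finite (State Vm Vp) := by
  refine Finite.of_injective
    (fun V : State Vm Vp => {z : region Vm Vp | (z : Point) ∈ V.1}) ?_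
  intro V W h
  apply Subtype.ext
  apply SetLike.ext
  intro z
  by_cases hm : z ∈ Vm
  · exact ⟨fun _ => W.2.1 hm, fun _ => V.2.1 hm⟩
  by_cases hp : z ∈ Vp
  · exact Set.ext_iff.1 h ⟨z, hp, hm⟩
  · exact ⟨fun hz => absurd (V.2.2 hz) hp, fun hz => absurd (W.2.2 hz) hp⟩

noncomputable instance instFintypeRegion (Vm Vp : PositiveMonotoneSet) [Finite (region Vm Vp)] :
    Fintype (region Vm Vp) :=
  Fintype.ofFinite _

noncomputable instance instFintypeState (Vm Vp : PositiveMonotoneSet) [Finite (region Vm Vp)] :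
    Fintype (State Vm Vp) :=
  haveI := finite_state Vm Vp
  Fintype.ofFinite _

noncomputable instance instDecidableEqState (Vm Vp : PositiveMonotoneSet) :
    DecidableEq (State Vm Vp) :=
  Classical.decEq _

open Classical in
/-- Transition probabilities of the update performed when the clock of the site `z` rings: if both
`V ∖ {z}` and `V ∪ {z}` are positive monotone sets, then `V` is replaced by one of them, each with
probability `1/2`; otherwise `V` is kept. -/
noncomputable def siteUpdate (Vm Vp : PositiveMonotoneSet) (z : Point) :
    Matrix (State Vm Vp) (State Vm Vp) ℝ :=
  fun V W =>
    if IsLowerSet ((V.1 : Set Point) \ {z}) ∧ IsLowerSet ((V.1 : Set Point) ∪ {z}) then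
      (if (W.1 : Set Point) = (V.1 : Set Point) \ {z} then 1 / 2 else 0) +
        (if (W.1 : Set Point) = (V.1 : Set Point) ∪ {z} then 1 / 2 else 0)
    else
      if W = V then 1 else 0

/-- The generator of the dynamics: every site of `Λ` is updated at the times of an independent
Poisson clock of rate one. -/
noncomputable def generator (Vm Vp : PositiveMonotoneSet) [Finite (region Vm Vp)] :
    Matrix (State Vm Vp) (State Vm Vp) ℝ :=
  ∑ z : region Vm Vp, (siteUpdate Vm Vp z - 1)

/-- The law at time `t` of the continuous-time Markov chain started from `V₀`, as a row of the
semigroup `exp (t L)` of the generator `L`. -/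
noncomputable def lawAt (Vm Vp : PositiveMonotoneSet) [Finite (region Vm Vp)] (t : ℝ)
    (V₀ : State Vm Vp) : State Vm Vp → ℝ :=
  fun W => NormedSpace.exp (t • generator Vm Vp) V₀ W

/-- The uniform probability on the state space, which is the invariant measure. -/
noncomputable def uniformLaw (Vm Vp : PositiveMonotoneSet) [Finite (region Vm Vp)] :
    State Vm Vp → ℝ :=
  fun _ => 1 / (Fintype.card (State Vm Vp) : ℝ)

/-- Total variation distance of two probability vectors. -/
noncomputable def tvDist {S : Type*} [Fintype S] (μ ν : S → ℝ) : ℝ :=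
  1 / 2 * ∑ s, |μ s - ν s|

/-- The mixing time `inf {t > 0 : sup_{V₀} ‖ν_t^{V₀} - ρ‖ ≤ ε}`, with the convention that the infimum
of the empty set is `∞`. -/
noncomputable def mixingTimeAt (Vm Vp : PositiveMonotoneSet) [Finite (region Vm Vp)] (ε : ℝ) :
    ℝ≥0∞ :=
  sInf {T : ℝ≥0∞ | ∃ t : ℝ, 0 < t ∧ T = ENNReal.ofReal t ∧
    ∀ V₀ : State Vm Vp, tvDist (lawAt Vm Vp t V₀) (uniformLaw Vm Vp) ≤ ε}

/-- The mixing time at the standard level `1/(2e)`. -/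
noncomputable def mixingTime (Vm Vp : PositiveMonotoneSet) [Finite (region Vm Vp)] : ℝ≥0∞ :=
  mixingTimeAt Vm Vp (1 / (2 * Real.exp 1))

/-! ### Exponentials of matrices acting on functions -/

section MatrixExponential

variable {Ω : Type*} [Fintype Ω] [DecidableEq Ω]

open scoped Matrix Matrix.Norms.Operator Nat

/-! Censoring reduces the problem to a dynamics whose mean volume can almost be computed, slicing
the columns by diagonals `x - y = d`.

Suppose that only the columns with `x - y` of one parity are updated. The four neighbours of such a
column have the other parity, so they are frozen. Its height is then a simple random walk reflected
at a floor, the maximum of the columns at `(x+1, y)` and `(x, y+1)`, and at a ceiling, the minimum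
of those at `(x-1, y)` and `(x, y-1)`, truncated to the region. After a time of order `H² log D` its
mean is the midpoint of floor and ceiling, up to a negative power of `D`
(`abs_exp_parityGenerator_colHeight_sub_le`).

The ceiling at `(x, y)` and the floor at `(x-1, y-1)` are the minimum and the maximum of the same
two columns, and `min + max` is their sum. Summed along a diagonal, the midpoints therefore give the
average volume of the two adjacent diagonals, up to boundary terms of favourable sign
(`monotone_average_sub_diagMid`). So the gap between the mean volumes started from `V⁺` and from
`V⁻` satisfies a discrete heat inequality in `d`, with zero values outside a window of width `O(D)`.
A strictly concave weight makes it contract by `1 - c/D²` per round, a round relaxing the even and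
then the odd diagonals (`weighted_bound_of_two_steps`). After order `D² log D` rounds the gap is
negligible, which gives the bound on the time.

The true dynamics updates all sites at once. Compare operators through `f ⬝ X g` for monotone `f`
and `g`: a site update lies below the identity, and nonnegative combinations and products of
monotone symmetric operators respect this order, hence so do exponentials. With `f` the indicator of
the top state minus that of the bottom state and `g` the volume, the true volume gap is at most the
censored one (`mixesBetter_alternatingRound_pow`). It controls the total variation distance because
twice the volume plus any function with values in `[-1, 1]` is monotone
(`tvDist_exp_flipGenerator_le`). -/

theorem hasSum_exp_smul_mulVec (A : Matrix Ω Ω ℝ) (t : ℝ) (f : Ω → ℝ) :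
    HasSum (fun n : ℕ => (t ^ n / n !) • (A ^ n *ᵥ f)) (NormedSpace.exp (t • A) *ᵥ f) := by
  have h := NormedSpace.exp_series_hasSum_exp' (𝕂 := ℝ) (t • A)
  have hc : Continuous fun B : Matrix Ω Ω ℝ => B *ᵥ f :=
    continuous_id.matrix_mulVec continuous_const
  convert h.map (Matrix.mulVec.addMonoidHomLeft f) hc using 1
  · funext n
    simp only [Function.comp_apply, Matrix.mulVec.addMonoidHomLeft, AddMonoidHom.coe_mk,
      ZeroHom.coe_mk, Matrix.smul_mulVec, smul_pow, smul_smul]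
    congr 1
    ring
  · rfl

/-- For `t ≥ 0` the partial sums of the exponential series stay in a convex cone stable under `A`.
Monotonicity, positivity and dependence on few sites pass in this way from a generator to its
semigroup. -/
theorem exp_smul_mulVec_mem {K : Set (Ω → ℝ)} (hK : IsClosed K) (h0 : (0 : Ω → ℝ) ∈ K)
    (hadd : ∀ f ∈ K, ∀ g ∈ K, f + g ∈ K) (hsmul : ∀ a : ℝ, 0 ≤ a → ∀ f ∈ K, a • f ∈ K)
    {A : Matrix Ω Ω ℝ} (hA : ∀ f ∈ K, A *ᵥ f ∈ K) {t : ℝ} (ht : 0 ≤ t) {f : Ω → ℝ} (hf : f ∈ K) :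
    NormedSpace.exp (t • A) *ᵥ f ∈ K := by
  have hpow : ∀ n : ℕ, A ^ n *ᵥ f ∈ K := by
    intro n
    induction n with
    | zero => simpa using hf
    | succ n ih => rw [pow_succ', ← Matrix.mulVec_mulVec]; exact hA _ ih
  refine hK.mem_of_tendsto (hasSum_exp_smul_mulVec A t f) (Filter.Eventually.of_forall fun s => ?_)
  exact Finset.sum_induction _ (· ∈ K) (fun a b ha hb => hadd a ha b hb) h0
    fun n _ => hsmul _ (by positivity) _ (hpow n)

theorem exp_smul_mulVec_of_mulVec_eq_zero {A : Matrix Ω Ω ℝ} {f : Ω → ℝ} (h : A *ᵥ f = 0) (t : ℝ) :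
    NormedSpace.exp (t • A) *ᵥ f = f := by
  refine (hasSum_exp_smul_mulVec A t f).unique ?_
  convert hasSum_single (0 : ℕ) ?_ using 1
  · simp
  · intro n hn
    obtain ⟨m, rfl⟩ := Nat.exists_eq_succ_of_ne_zero hn
    rw [Nat.succ_eq_add_one, pow_succ A, ← Matrix.mulVec_mulVec, h]
    simp

theorem exp_smul_sub_smul_one (R : Matrix Ω Ω ℝ) (c t : ℝ) :
    NormedSpace.exp (t • (R - c • (1 : Matrix Ω Ω ℝ))) =
      Real.exp (-(t * c)) • NormedSpace.exp (t • R) := by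
  have e : t • (R - c • (1 : Matrix Ω Ω ℝ)) = (-(t * c)) • (1 : Matrix Ω Ω ℝ) + t • R := by
    rw [smul_sub, smul_smul, neg_smul]; abel
  rw [e, Matrix.exp_add_of_commute _ _ ((Commute.one_left _).smul_left _)]
  have : NormedSpace.exp ((-(t * c)) • (1 : Matrix Ω Ω ℝ)) = Real.exp (-(t * c)) • 1 := by
    rw [← Algebra.algebraMap_eq_smul_one, ← Algebra.algebraMap_eq_smul_one, Real.exp_eq_exp_ℝ]
    exact (NormedSpace.algebraMap_exp_comm (-(t * c))).symm
  rw [this, smul_mul_assoc, one_mul]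

theorem hasDerivAt_exp_smul_mulVec (A : Matrix Ω Ω ℝ) (f : Ω → ℝ) (v : Ω) (t : ℝ) :
    HasDerivAt (fun s : ℝ => (NormedSpace.exp (s • A) *ᵥ f) v)
      ((A *ᵥ (NormedSpace.exp (t • A) *ᵥ f)) v) t := by
  have h := hasDerivAt_exp_smul_const' (𝕂 := ℝ) A t
  rw [Matrix.mulVec_mulVec]
  let Φ : Matrix Ω Ω ℝ →ₗ[ℝ] ℝ :=
    { toFun := fun B => (B *ᵥ f) v
      map_add' := fun B C => by simp [Matrix.add_mulVec]
      map_smul' := fun a B => by simp [Matrix.smul_mulVec] }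
  exact (LinearMap.toContinuousLinearMap Φ).hasFDerivAt.comp_hasDerivAt t h

end MatrixExponential

/-! ### Comparison of monotone operators, censoring, total variation -/

section MonotoneFlips

set_option linter.unusedSectionVars false

open scoped Matrix Nat

variable {Ω : Type*} [Fintype Ω] [DecidableEq Ω] [PartialOrder Ω]

/-- `Q` resamples uniformly within the pairs `{v, s v}`, where `s` is an involution that moves each
element to a comparable one, in such a way that monotone functions are preserved. -/
structure IsMonotoneFlip (Q : Matrix Ω Ω ℝ) (s : Ω → Ω) : Prop where
  mulVec_apply : ∀ (f : Ω → ℝ) (v : Ω), (Q *ᵥ f) v = (f v + f (s v)) / 2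
  involutive : Function.Involutive s
  comparable : ∀ v, v ≤ s v ∨ s v ≤ v
  monotone_mulVec : ∀ f : Ω → ℝ, Monotone f → Monotone (Q *ᵥ f)

/-- Symmetric matrices that preserve monotone functions. -/
structure IsSymmMonotone (X : Matrix Ω Ω ℝ) : Prop where
  isSymm : X.IsSymm
  monotone_mulVec : ∀ f : Ω → ℝ, Monotone f → Monotone (X *ᵥ f)

/-- `X` mixes monotone functions better than `Y`. -/
def MixesBetter (X Y : Matrix Ω Ω ℝ) : Prop :=
  ∀ f g : Ω → ℝ, Monotone f → Monotone g → f ⬝ᵥ (X *ᵥ g) ≤ f ⬝ᵥ (Y *ᵥ g)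

theorem Matrix.IsSymm.dotProduct_mulVec_comm {X : Matrix Ω Ω ℝ} (hX : X.IsSymm) (f g : Ω → ℝ) :
    f ⬝ᵥ (X *ᵥ g) = (X *ᵥ f) ⬝ᵥ g := by
  rw [Matrix.dotProduct_mulVec, ← Matrix.mulVec_transpose, hX.eq]

theorem IsMonotoneFlip.isSymmMonotone {Q : Matrix Ω Ω ℝ} {s : Ω → Ω} (h : IsMonotoneFlip Q s) :
    IsSymmMonotone Q := by
  refine ⟨?_, h.monotone_mulVec⟩
  ext v w
  have e : ∀ a b, Q a b = ((if a = b then 1 else 0) + (if s a = b then 1 else 0)) / 2 := by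
    intro a b
    have := h.mulVec_apply (Pi.single b 1) a
    simpa [Pi.single_apply] using this
  have hs : s w = v ↔ s v = w := ⟨fun hh => hh ▸ h.involutive w, fun hh => hh ▸ h.involutive v⟩
  simp only [Matrix.transpose_apply, e, eq_comm (a := w) (b := v), hs]

/-- The difference of the two forms is a quarter of `∑ (f (s v) - f v) * (g (s v) - g v)`, whose
terms are nonnegative since `v` and `s v` are comparable. -/
theorem IsMonotoneFlip.mixesBetter_one {Q : Matrix Ω Ω ℝ} {s : Ω → Ω} (h : IsMonotoneFlip Q s) :
    MixesBetter Q 1 := by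
  intro f g hf hg
  have hsum : ∑ v, f (s v) * g (s v) = ∑ v, f v * g v :=
    Equiv.sum_comp h.involutive.toPerm fun v => f v * g v
  have hsum2 : ∑ v, f (s v) * g v = ∑ v, f v * g (s v) := by
    rw [← Equiv.sum_comp h.involutive.toPerm fun v => f (s v) * g v]
    exact Finset.sum_congr rfl fun v _ => by
      simp [h.involutive v]
  have hpos : 0 ≤ ∑ v, (f (s v) - f v) * (g (s v) - g v) := by
    refine Finset.sum_nonneg fun v _ => ?_
    rcases h.comparable v with hv | hv
    · exact mul_nonneg (sub_nonneg.2 (hf hv)) (sub_nonneg.2 (hg hv))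
    · exact mul_nonneg_of_nonpos_of_nonpos (sub_nonpos.2 (hf hv)) (sub_nonpos.2 (hg hv))
  have hexp : ∑ v, (f (s v) - f v) * (g (s v) - g v) =
      ∑ v, f (s v) * g (s v) - ∑ v, f (s v) * g v - ∑ v, f v * g (s v) + ∑ v, f v * g v := by
    rw [← Finset.sum_sub_distrib, ← Finset.sum_sub_distrib, ← Finset.sum_add_distrib]
    exact Finset.sum_congr rfl fun v _ => by ring
  have hQ : f ⬝ᵥ (Q *ᵥ g) = (∑ v, f v * g v + ∑ v, f v * g (s v)) / 2 := by
    rw [dotProduct, ← Finset.sum_add_distrib, Finset.sum_div]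
    exact Finset.sum_congr rfl fun v _ => by rw [h.mulVec_apply]; ring
  have h1 : f ⬝ᵥ ((1 : Matrix Ω Ω ℝ) *ᵥ g) = ∑ v, f v * g v := by
    rw [Matrix.one_mulVec]; rfl
  rw [hQ, h1]
  linarith

theorem IsSymmMonotone.one : IsSymmMonotone (1 : Matrix Ω Ω ℝ) :=
  ⟨Matrix.isSymm_one, fun f hf => by simpa using hf⟩

theorem IsSymmMonotone.zero : IsSymmMonotone (0 : Matrix Ω Ω ℝ) :=
  ⟨Matrix.isSymm_zero, fun f _ => by
    rw [Matrix.zero_mulVec]; exact monotone_const⟩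

theorem IsSymmMonotone.add {X Y : Matrix Ω Ω ℝ} (hX : IsSymmMonotone X) (hY : IsSymmMonotone Y) :
    IsSymmMonotone (X + Y) :=
  ⟨hX.isSymm.add hY.isSymm, fun f hf => by
    rw [Matrix.add_mulVec]
    exact (hX.monotone_mulVec f hf).add (hY.monotone_mulVec f hf)⟩

theorem IsSymmMonotone.smul {X : Matrix Ω Ω ℝ} (hX : IsSymmMonotone X) {a : ℝ} (ha : 0 ≤ a) :
    IsSymmMonotone (a • X) :=
  ⟨hX.isSymm.smul a, fun f hf => by
    rw [Matrix.smul_mulVec]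
    exact (hX.monotone_mulVec f hf).const_smul ha⟩

theorem IsSymmMonotone.sum {ι : Type*} {X : ι → Matrix Ω Ω ℝ} (s : Finset ι)
    (hX : ∀ i, IsSymmMonotone (X i)) : IsSymmMonotone (∑ i ∈ s, X i) :=
  Finset.sum_induction _ _ (fun _ _ => IsSymmMonotone.add) IsSymmMonotone.zero fun i _ => hX i

theorem IsSymmMonotone.monotone_pow_mulVec {X : Matrix Ω Ω ℝ} (hX : IsSymmMonotone X) (n : ℕ)
    {f : Ω → ℝ} (hf : Monotone f) : Monotone (X ^ n *ᵥ f) := by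
  induction n with
  | zero => simpa using hf
  | succ n ih => rw [pow_succ', ← Matrix.mulVec_mulVec]; exact hX.monotone_mulVec _ ih

theorem isClosed_setOf_monotone_real : IsClosed {f : Ω → ℝ | Monotone f} := by
  have : {f : Ω → ℝ | Monotone f} = ⋂ v, ⋂ w, ⋂ _ : v ≤ w, {f : Ω → ℝ | f v ≤ f w} := by
    ext f; simp [Monotone]
  rw [this]
  exact isClosed_iInter fun v => isClosed_iInter fun w => isClosed_iInter fun _ =>
    isClosed_le (continuous_apply v) (continuous_apply w)

theorem IsSymmMonotone.exp_smul {X : Matrix Ω Ω ℝ} (hX : IsSymmMonotone X) {t : ℝ} (ht : 0 ≤ t) :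
    IsSymmMonotone (NormedSpace.exp (t • X)) := by
  refine ⟨(hX.isSymm.smul t).exp, fun f hf => ?_⟩
  exact exp_smul_mulVec_mem (K := {f : Ω → ℝ | Monotone f}) isClosed_setOf_monotone_real
    monotone_const (fun f hf g hg => hf.add hg) (fun a ha f hf => hf.const_smul ha)
    hX.monotone_mulVec ht hf

theorem MixesBetter.refl (X : Matrix Ω Ω ℝ) : MixesBetter X X := fun _ _ _ _ => le_rfl

theorem MixesBetter.add {X Y X' Y' : Matrix Ω Ω ℝ} (h : MixesBetter X Y) (h' : MixesBetter X' Y') :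
    MixesBetter (X + X') (Y + Y') := by
  intro f g hf hg
  rw [Matrix.add_mulVec, Matrix.add_mulVec, dotProduct_add, dotProduct_add]
  exact add_le_add (h f g hf hg) (h' f g hf hg)

theorem MixesBetter.sum {ι : Type*} {X Y : ι → Matrix Ω Ω ℝ} (s : Finset ι)
    (h : ∀ i ∈ s, MixesBetter (X i) (Y i)) : MixesBetter (∑ i ∈ s, X i) (∑ i ∈ s, Y i) := by
  classical
  induction s using Finset.induction_on with
  | empty => exact MixesBetter.refl _
  | insert a s ha ih =>
    rw [Finset.sum_insert ha, Finset.sum_insert ha]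
    exact (h a (Finset.mem_insert_self a s)).add (ih fun i hi => h i (Finset.mem_insert_of_mem hi))

theorem MixesBetter.smul {X Y : Matrix Ω Ω ℝ} (h : MixesBetter X Y) {a : ℝ} (ha : 0 ≤ a) :
    MixesBetter (a • X) (a • Y) := by
  intro f g hf hg
  rw [Matrix.smul_mulVec, Matrix.smul_mulVec, dotProduct_smul, dotProduct_smul]
  exact smul_le_smul_of_nonneg_left (h f g hf hg) ha

/-- The factors are replaced one at a time: first `X` by `Y` against the monotone `X' g`, then, once
the symmetric `Y` has moved to the other side, `X'` by `Y'` against the monotone `Y f`. No symmetry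
of `Y'` is needed, so products can be built up from the left. -/
theorem MixesBetter.mul {X Y X' Y' : Matrix Ω Ω ℝ} (h : MixesBetter X Y) (h' : MixesBetter X' Y')
    (hX' : ∀ f : Ω → ℝ, Monotone f → Monotone (X' *ᵥ f)) (hY : IsSymmMonotone Y) :
    MixesBetter (X * X') (Y * Y') := by
  intro f g hf hg
  rw [← Matrix.mulVec_mulVec, ← Matrix.mulVec_mulVec]
  refine (h f _ hf (hX' g hg)).trans ?_
  rw [hY.isSymm.dotProduct_mulVec_comm, hY.isSymm.dotProduct_mulVec_comm]
  exact h' _ g (hY.monotone_mulVec f hf) hg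

theorem MixesBetter.pow {X Y : Matrix Ω Ω ℝ} (h : MixesBetter X Y) (hX : IsSymmMonotone X)
    (hY : IsSymmMonotone Y) (n : ℕ) : MixesBetter (X ^ n) (Y ^ n) := by
  induction n with
  | zero => simpa using MixesBetter.refl (1 : Matrix Ω Ω ℝ)
  | succ n ih =>
    rw [pow_succ', pow_succ']
    exact h.mul ih (fun f hf => hX.monotone_pow_mulVec n hf) hY

theorem MixesBetter.exp_smul {X Y : Matrix Ω Ω ℝ} (h : MixesBetter X Y) (hX : IsSymmMonotone X)
    (hY : IsSymmMonotone Y) {t : ℝ} (ht : 0 ≤ t) :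
    MixesBetter (NormedSpace.exp (t • X)) (NormedSpace.exp (t • Y)) := by
  intro f g hf hg
  have key : ∀ Z : Matrix Ω Ω ℝ, HasSum (fun n : ℕ => (t ^ n / n !) * (f ⬝ᵥ (Z ^ n *ᵥ g)))
      (f ⬝ᵥ (NormedSpace.exp (t • Z) *ᵥ g)) := by
    intro Z
    have hs : ∀ v ∈ (Finset.univ : Finset Ω), HasSum
        (fun n : ℕ => f v * ((t ^ n / n !) * (Z ^ n *ᵥ g) v))
        (f v * (NormedSpace.exp (t • Z) *ᵥ g) v) := fun v _ =>
      (Pi.hasSum.1 (hasSum_exp_smul_mulVec Z t g) v).mul_left (f v)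
    have := hasSum_sum hs
    convert this using 1
    · funext n
      rw [dotProduct, Finset.mul_sum]
      exact Finset.sum_congr rfl fun v _ => by ring
    · rfl
  exact hasSum_le (fun n => mul_le_mul_of_nonneg_left ((h.pow hX hY n) f g hf hg) (by positivity))
    (key X) (key Y)

/-- The generator that updates the sites of `A` at rate one. -/
def flipGenerator {ι : Type*} (P : ι → Matrix Ω Ω ℝ) (A : Finset ι) : Matrix Ω Ω ℝ :=
  ∑ z ∈ A, (P z - 1)

section Generator

variable {ι : Type*} [Fintype ι] [DecidableEq ι] {P : ι → Matrix Ω Ω ℝ} {σ : ι → Ω → Ω}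

/-- A censored site contributes the identity in place of its update, so all the generators share the
same scalar shift, and comparing their exponentials amounts to comparing sums of order-preserving
matrices. -/
theorem flipGenerator_eq (P : ι → Matrix Ω Ω ℝ) (A : Finset ι) :
    flipGenerator P A =
      (∑ z ∈ A, P z + ∑ _z ∈ Aᶜ, 1) - (Fintype.card ι : ℝ) • (1 : Matrix Ω Ω ℝ) := by
  have h : ∑ _z ∈ A, (1 : Matrix Ω Ω ℝ) + ∑ _z ∈ Aᶜ, (1 : Matrix Ω Ω ℝ) =
      (Fintype.card ι : ℝ) • (1 : Matrix Ω Ω ℝ) := by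
    rw [Finset.sum_add_sum_compl A fun _ => (1 : Matrix Ω Ω ℝ)]
    simp [← Nat.cast_smul_eq_nsmul ℝ]
  rw [flipGenerator, Finset.sum_sub_distrib, ← h]
  abel

theorem isSymmMonotone_exp_flipGenerator (hP : ∀ z, IsMonotoneFlip (P z) (σ z)) (A : Finset ι)
    {t : ℝ} (ht : 0 ≤ t) : IsSymmMonotone (NormedSpace.exp (t • flipGenerator P A)) := by
  rw [flipGenerator_eq, exp_smul_sub_smul_one]
  exact (((IsSymmMonotone.sum A fun z => (hP z).isSymmMonotone).add
    (IsSymmMonotone.sum Aᶜ fun _ => IsSymmMonotone.one)).exp_smul ht).smul (Real.exp_pos _).le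

/-- Censoring: suppressing updates slows down the mixing of monotone functions. -/
theorem mixesBetter_exp_flipGenerator (hP : ∀ z, IsMonotoneFlip (P z) (σ z)) (A : Finset ι)
    {t : ℝ} (ht : 0 ≤ t) :
    MixesBetter (NormedSpace.exp (t • flipGenerator P Finset.univ))
      (NormedSpace.exp (t • flipGenerator P A)) := by
  have hs := fun (B : Finset ι) => IsSymmMonotone.sum B fun z => (hP z).isSymmMonotone
  have ho := fun (B : Finset ι) => IsSymmMonotone.sum (Ω := Ω) B fun _ => IsSymmMonotone.one
  rw [flipGenerator_eq P A, flipGenerator_eq P Finset.univ, exp_smul_sub_smul_one,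
    exp_smul_sub_smul_one]
  refine MixesBetter.smul ?_ (Real.exp_pos _).le
  refine MixesBetter.exp_smul ?_ ((hs _).add (ho _)) ((hs _).add (ho _)) ht
  rw [Finset.compl_univ, Finset.sum_empty, add_zero, ← Finset.sum_add_sum_compl A P]
  exact (MixesBetter.refl _).add (MixesBetter.sum _ fun z _ => (hP z).mixesBetter_one)

theorem flipGenerator_mulVec_apply (hP : ∀ z, IsMonotoneFlip (P z) (σ z)) (A : Finset ι)
    (f : Ω → ℝ) (v : Ω) :
    (flipGenerator P A *ᵥ f) v = ∑ z ∈ A, (f (σ z v) - f v) / 2 := by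
  rw [flipGenerator, Matrix.sum_mulVec, Finset.sum_apply]
  refine Finset.sum_congr rfl fun z _ => ?_
  rw [Matrix.sub_mulVec, Pi.sub_apply, (hP z).mulVec_apply, Matrix.one_mulVec]
  ring

theorem exp_flipGenerator_mulVec_of_invariant (hP : ∀ z, IsMonotoneFlip (P z) (σ z)) (A : Finset ι)
    (t : ℝ) {f : Ω → ℝ} (hf : ∀ z ∈ A, ∀ v, f (σ z v) = f v) :
    NormedSpace.exp (t • flipGenerator P A) *ᵥ f = f := by
  refine exp_smul_mulVec_of_mulVec_eq_zero ?_ t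
  funext v
  rw [flipGenerator_mulVec_apply hP]
  exact Finset.sum_eq_zero fun z hz => by rw [hf z hz, sub_self, zero_div]

theorem exp_flipGenerator_mulVec_mono (hP : ∀ z, IsMonotoneFlip (P z) (σ z)) (A : Finset ι)
    {t : ℝ} (ht : 0 ≤ t) {f g : Ω → ℝ} (hfg : f ≤ g) :
    NormedSpace.exp (t • flipGenerator P A) *ᵥ f ≤ NormedSpace.exp (t • flipGenerator P A) *ᵥ g := by
  have hpos : ∀ f : Ω → ℝ, 0 ≤ f → 0 ≤ NormedSpace.exp (t • flipGenerator P A) *ᵥ f := by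
    intro f hf
    rw [flipGenerator_eq, exp_smul_sub_smul_one, Matrix.smul_mulVec]
    refine smul_nonneg (Real.exp_pos _).le ?_
    refine exp_smul_mulVec_mem (K := {f : Ω → ℝ | 0 ≤ f}) isClosed_Ici (le_refl (0 : Ω → ℝ))
      (fun f hf g hg v => add_nonneg (hf v) (hg v)) (fun a ha f hf v => mul_nonneg ha (hf v)) ?_ ht hf
    intro g hg v
    rw [Matrix.add_mulVec, Matrix.sum_mulVec, Matrix.sum_mulVec]
    simp only [Pi.add_apply, Finset.sum_apply, Matrix.one_mulVec, (hP _).mulVec_apply]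
    have hg' : ∀ v, 0 ≤ g v := hg
    exact add_nonneg (Finset.sum_nonneg fun z _ => by linarith [hg' v, hg' (σ z v)])
      (Finset.sum_nonneg fun _ _ => hg' v)
  have := hpos (g - f) (sub_nonneg.2 hfg)
  rwa [Matrix.mulVec_sub, sub_nonneg] at this

theorem exp_flipGenerator_mulVec_const (hP : ∀ z, IsMonotoneFlip (P z) (σ z)) (A : Finset ι)
    (t a : ℝ) : NormedSpace.exp (t • flipGenerator P A) *ᵥ (fun _ => a) = fun _ => a :=
  exp_flipGenerator_mulVec_of_invariant hP A t fun _ _ _ => rfl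

/-- The distance to equilibrium from any starting point is controlled by the expectations, from the
two extremal starting points, of any function that increases at least by one along strict
inequalities. -/
theorem tvDist_exp_flipGenerator_le (hP : ∀ z, IsMonotoneFlip (P z) (σ z)) {t : ℝ} (ht : 0 ≤ t)
    {vol : Ω → ℝ} (hvol : ∀ v w, v < w → vol v + 1 ≤ vol w) {bot top : Ω} (hbot : ∀ v, bot ≤ v)
    (htop : ∀ v, v ≤ top) (v₀ : Ω) :
    tvDist (fun w => NormedSpace.exp (t • flipGenerator P Finset.univ) v₀ w)
        (fun _ => 1 / (Fintype.card Ω : ℝ)) ≤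
      2 * ((NormedSpace.exp (t • flipGenerator P Finset.univ) *ᵥ vol) top -
        (NormedSpace.exp (t • flipGenerator P Finset.univ) *ᵥ vol) bot) := by
  set p := NormedSpace.exp (t • flipGenerator P Finset.univ) with hp
  have hsm : IsSymmMonotone p := isSymmMonotone_exp_flipGenerator hP _ ht
  have hcard : (0 : ℝ) < Fintype.card Ω := by
    have : Nonempty Ω := ⟨v₀⟩
    exact_mod_cast Fintype.card_pos
  set δ := (p *ᵥ vol) top - (p *ᵥ vol) bot with hδ
  -- The sign of the discrepancy, the extremal test function for total variation.
  obtain ⟨f, hf⟩ : ∃ f : Ω → ℝ, ∀ w, |f w| ≤ 1 ∧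
      |p v₀ w - 1 / (Fintype.card Ω : ℝ)| = (p v₀ w - 1 / (Fintype.card Ω : ℝ)) * f w := by
    refine ⟨fun w => if 0 ≤ p v₀ w - 1 / (Fintype.card Ω : ℝ) then 1 else -1, fun w => ?_⟩
    dsimp only
    split_ifs with h
    · exact ⟨by simp, by rw [abs_of_nonneg h, mul_one]⟩
    · exact ⟨by simp, by rw [abs_of_neg (not_le.1 h), mul_neg_one]⟩
  -- Between comparable states `a * f` drops by at most 2, which `2 * vol` makes up for.
  have hmono : ∀ a : ℝ, |a| ≤ 1 → Monotone (fun w => a * f w + 2 * vol w) := by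
    intro a ha v w hvw
    rcases hvw.eq_or_lt with rfl | hlt
    · exact le_rfl
    have h1 : |a * f v| ≤ 1 := by
      rw [abs_mul]; exact mul_le_one₀ ha (abs_nonneg _) (hf v).1
    have h2 : |a * f w| ≤ 1 := by
      rw [abs_mul]; exact mul_le_one₀ ha (abs_nonneg _) (hf w).1
    have := hvol v w hlt
    dsimp only
    linarith [(abs_le.1 h1).2, (abs_le.1 h2).1]
  have hmono' : ∀ a : ℝ, |a| ≤ 1 → Monotone (fun w => a * (p *ᵥ f) w + 2 * (p *ᵥ vol) w) := by
    intro a ha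
    have h := hsm.monotone_mulVec _ (hmono a ha)
    have e : (fun w => a * f w + 2 * vol w) = a • f + (2 : ℝ) • vol := rfl
    rw [e, Matrix.mulVec_add, Matrix.mulVec_smul, Matrix.mulVec_smul] at h
    exact h
  -- Compare `v` and `w` with `bot`, at a cost of `2 * δ` each.
  have hdiff : ∀ v w, (p *ᵥ f) v - (p *ᵥ f) w ≤ 4 * δ := by
    intro v w
    have hvm : Monotone (p *ᵥ vol) := hsm.monotone_mulVec _ fun v w hvw => by
      rcases hvw.eq_or_lt with rfl | hlt
      · exact le_rfl
      · linarith [hvol v w hlt]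
    have h1 := hmono' (-1) (by simp) (hbot v)
    have h2 := hmono' 1 (by simp) (hbot w)
    dsimp only at h1 h2
    have h3 := hvm (htop v)
    have h4 := hvm (htop w)
    linarith
  have hone : p *ᵥ (fun _ => (1 : ℝ)) = fun _ => 1 := exp_flipGenerator_mulVec_const hP _ t 1
  -- Invariance of the uniform measure, from symmetry and preservation of constants.
  have havg : ∑ v, (p *ᵥ f) v = ∑ w, f w := by
    have h1 := hsm.isSymm.dotProduct_mulVec_comm (fun _ => (1 : ℝ)) f
    rw [hone] at h1
    simpa [dotProduct] using h1
  have hmain : ∑ w, |p v₀ w - 1 / (Fintype.card Ω : ℝ)| ≤ 4 * δ := by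
    have e1 : ∑ w, |p v₀ w - 1 / (Fintype.card Ω : ℝ)| =
        (p *ᵥ f) v₀ - 1 / (Fintype.card Ω : ℝ) * ∑ v, (p *ᵥ f) v := by
      rw [havg, Finset.mul_sum, Matrix.mulVec, dotProduct, ← Finset.sum_sub_distrib]
      exact Finset.sum_congr rfl fun w _ => by rw [(hf w).2]; ring
    have e2 : (p *ᵥ f) v₀ - 1 / (Fintype.card Ω : ℝ) * ∑ v, (p *ᵥ f) v =
        1 / (Fintype.card Ω : ℝ) * ∑ v, ((p *ᵥ f) v₀ - (p *ᵥ f) v) := by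
      rw [Finset.sum_sub_distrib]
      simp only [Finset.sum_const, Finset.card_univ, nsmul_eq_mul]
      field_simp
    rw [e1, e2]
    calc 1 / (Fintype.card Ω : ℝ) * ∑ v, ((p *ᵥ f) v₀ - (p *ᵥ f) v)
        ≤ 1 / (Fintype.card Ω : ℝ) * ∑ _v : Ω, 4 * δ := by
          gcongr with v; exact hdiff v₀ v
      _ = 4 * δ := by
          simp only [Finset.sum_const, Finset.card_univ, nsmul_eq_mul]
          field_simp
  rw [tvDist]
  linarith

end Generator

end MonotoneFlips

/-! ### Site updates are monotone flips -/

section StateFlips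

open scoped Matrix

/-- Adding or removing `z` leaves `V` a lower set. -/
def Flippable (V : PositiveMonotoneSet) (z : Point) : Prop :=
  (∀ y < z, y ∈ V) ∧ ∀ y, z < y → y ∉ V

theorem flippable_iff (V : PositiveMonotoneSet) (z : Point) :
    IsLowerSet ((V : Set Point) \ {z}) ∧ IsLowerSet ((V : Set Point) ∪ {z}) ↔ Flippable V z := by
  constructor
  · rintro ⟨h1, h2⟩
    refine ⟨fun y hy => ?_, fun y hy hyV => ?_⟩
    · rcases h2 hy.le (Or.inr rfl) with h | h
      · exact h
      · exact absurd h hy.ne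
    · exact (h1 hy.le ⟨hyV, hy.ne'⟩).2 rfl
  · rintro ⟨h1, h2⟩
    constructor
    · rintro a b hba ⟨ha, haz⟩
      refine ⟨V.lower hba ha, ?_⟩
      rintro rfl
      exact h2 a (lt_of_le_of_ne hba fun h => haz h.symm) ha
    · rintro a b hba (ha | rfl)
      · exact Or.inl (V.lower hba ha)
      · rcases hba.eq_or_lt with h | h
        · exact Or.inr h
        · exact Or.inl (h1 b h)

variable {Vm Vp : PositiveMonotoneSet}

open Classical in
/-- Adds or removes the site `z` when this is allowed. -/
noncomputable def flipState (z : region Vm Vp) (V : State Vm Vp) : State Vm Vp :=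
  if h : Flippable V.1 z then
    if (z : Point) ∈ V.1 then
      ⟨⟨(V.1 : Set Point) \ {(z : Point)}, ((flippable_iff V.1 z).2 h).1⟩,
        fun _ hy => ⟨V.2.1 hy, fun hyz => z.2.2 (Set.mem_singleton_iff.1 hyz ▸ hy)⟩,
        fun _ hy => V.2.2 hy.1⟩
    else
      ⟨⟨(V.1 : Set Point) ∪ {(z : Point)}, ((flippable_iff V.1 z).2 h).2⟩,
        fun _ hy => Or.inl (V.2.1 hy),
        fun _ hy => hy.elim (fun h => V.2.2 h) fun h => (Set.mem_singleton_iff.1 h).symm ▸ z.2.1⟩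
  else V

theorem flipState_of_not_flippable {z : region Vm Vp} {V : State Vm Vp}
    (h : ¬Flippable V.1 z) : flipState z V = V := by
  rw [flipState, dif_neg h]

theorem coe_flipState_of_mem {z : region Vm Vp} {V : State Vm Vp} (h : Flippable V.1 z)
    (hz : (z : Point) ∈ V.1) :
    ((flipState z V).1 : Set Point) = (V.1 : Set Point) \ {(z : Point)} := by
  rw [flipState, dif_pos h, if_pos hz]; rfl

theorem coe_flipState_of_notMem {z : region Vm Vp} {V : State Vm Vp} (h : Flippable V.1 z)
    (hz : (z : Point) ∉ V.1) :
    ((flipState z V).1 : Set Point) = (V.1 : Set Point) ∪ {(z : Point)} := by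
  rw [flipState, dif_pos h, if_neg hz]; rfl

theorem mem_flipState_of_ne (z : region Vm Vp) (V : State Vm Vp) {y : Point} (hy : y ≠ z) :
    y ∈ (flipState z V).1 ↔ y ∈ V.1 := by
  by_cases h : Flippable V.1 z
  · by_cases hz : (z : Point) ∈ V.1
    · rw [← SetLike.mem_coe, coe_flipState_of_mem h hz]; simp [hy]
    · rw [← SetLike.mem_coe, coe_flipState_of_notMem h hz]; simp [hy]
  · rw [flipState_of_not_flippable h]

theorem mem_flipState_self {z : region Vm Vp} {V : State Vm Vp} (h : Flippable V.1 z) :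
    (z : Point) ∈ (flipState z V).1 ↔ (z : Point) ∉ V.1 := by
  by_cases hz : (z : Point) ∈ V.1
  · rw [← SetLike.mem_coe, coe_flipState_of_mem h hz]; simp [hz]
  · rw [← SetLike.mem_coe, coe_flipState_of_notMem h hz]; simp [hz]

theorem flippable_flipState (z : region Vm Vp) (V : State Vm Vp) :
    Flippable (flipState z V).1 z ↔ Flippable V.1 z := by
  refine and_congr (forall₂_congr fun y hy => ?_) (forall₂_congr fun y hy => ?_)
  · exact mem_flipState_of_ne z V hy.ne
  · exact not_congr (mem_flipState_of_ne z V hy.ne')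

theorem State.ext_mem {V W : State Vm Vp} (h : ∀ y, y ∈ V.1 ↔ y ∈ W.1) : V = W :=
  Subtype.ext (SetLike.ext h)

theorem flipState_involutive (z : region Vm Vp) :
    Function.Involutive (flipState (Vm := Vm) (Vp := Vp) z) := by
  intro V
  by_cases h : Flippable V.1 z
  · refine State.ext_mem fun y => ?_
    by_cases hy : y = z
    · subst hy
      rw [mem_flipState_self ((flippable_flipState z V).2 h), mem_flipState_self h, not_not]
    · rw [mem_flipState_of_ne z _ hy, mem_flipState_of_ne z _ hy]
  · rw [flipState_of_not_flippable (V := flipState z V) fun h' => h ((flippable_flipState z V).1 h'),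
      flipState_of_not_flippable h]

theorem le_flipState_of_notMem {z : region Vm Vp} {V W : State Vm Vp} (hVW : V ≤ W)
    (hz : (z : Point) ∉ V.1) : V ≤ flipState z W := by
  intro y hy
  have hyz : y ≠ z := fun h => hz (h ▸ hy)
  exact (mem_flipState_of_ne z W hyz).2 (hVW hy)

theorem flipState_le_of_mem {z : region Vm Vp} {V W : State Vm Vp} (hVW : V ≤ W)
    (hz : (z : Point) ∈ W.1) : flipState z V ≤ W := by
  intro y hy
  by_cases hyz : y = z
  · exact hyz ▸ hz
  · exact hVW ((mem_flipState_of_ne z V hyz).1 hy)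

theorem flipState_le_flipState {z : region Vm Vp} {V W : State Vm Vp} (hVW : V ≤ W)
    (hV : Flippable V.1 z) (hW : Flippable W.1 z) (hz : (z : Point) ∈ V.1 ↔ (z : Point) ∈ W.1) :
    flipState z V ≤ flipState z W := by
  intro y hy
  by_cases hyz : y = z
  · subst hyz
    exact (mem_flipState_self hW).2 fun h => (mem_flipState_self hV).1 hy (hz.2 h)
  · exact (mem_flipState_of_ne z W hyz).2 (hVW ((mem_flipState_of_ne z V hyz).1 hy))

variable [Finite (region Vm Vp)]

theorem siteUpdate_mulVec_apply (z : region Vm Vp) (f : State Vm Vp → ℝ) (V : State Vm Vp) :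
    (siteUpdate Vm Vp z *ᵥ f) V = (f V + f (flipState z V)) / 2 := by
  classical
  have hsum : ∀ W₀ : State Vm Vp,
      ∑ W : State Vm Vp, (if (W.1 : Set Point) = (W₀.1 : Set Point) then (1 / 2 : ℝ) else 0) * f W =
        f W₀ / 2 := by
    intro W₀
    rw [Finset.sum_eq_single W₀]
    · rw [if_pos rfl]; ring
    · intro W _ hW
      rw [if_neg fun h => hW (Subtype.ext (SetLike.coe_injective h)), zero_mul]
    · simp
  rw [Matrix.mulVec, dotProduct]
  by_cases h : Flippable V.1 z
  · have h' := (flippable_iff V.1 z).2 h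
    simp only [siteUpdate, if_pos h', add_mul, Finset.sum_add_distrib]
    by_cases hz : (z : Point) ∈ V.1
    · have e1 := coe_flipState_of_mem h hz
      have e2 : (V.1 : Set Point) ∪ {(z : Point)} = (V.1 : Set Point) := by simpa using hz
      rw [← e1, e2, hsum, hsum]; ring
    · have e1 := coe_flipState_of_notMem h hz
      have e2 : (V.1 : Set Point) \ {(z : Point)} = (V.1 : Set Point) := by simpa using hz
      rw [← e1, e2, hsum, hsum]; ring
  · have h' : ¬(IsLowerSet ((V.1 : Set Point) \ {(z : Point)}) ∧
        IsLowerSet ((V.1 : Set Point) ∪ {(z : Point)})) := fun hh => h ((flippable_iff V.1 z).1 hh)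
    simp only [siteUpdate, if_neg h', flipState_of_not_flippable h]
    simp

/-- For `V ≤ W` the pairs `{V, flip V}` and `{W, flip W}` are matched in order, crosswise when `z`
lies in `W` only. If `z` is flippable for `V` alone, then `W` contains everything below `z`, so a
point above blocks it and `z ∈ W`; symmetrically, if it is flippable for `W` alone, `z ∉ V`. -/
theorem isMonotoneFlip_siteUpdate (z : region Vm Vp) :
    IsMonotoneFlip (siteUpdate Vm Vp z) (flipState z) := by
  refine ⟨siteUpdate_mulVec_apply z, flipState_involutive z, fun V => ?_, fun f hf V W hVW => ?_⟩
  · by_cases hz : (z : Point) ∈ V.1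
    · exact Or.inr (flipState_le_of_mem le_rfl hz)
    · exact Or.inl (le_flipState_of_notMem le_rfl hz)
  rw [siteUpdate_mulVec_apply, siteUpdate_mulVec_apply]
  suffices f V + f (flipState z V) ≤ f W + f (flipState z W) by linarith
  by_cases hV : Flippable V.1 z <;> by_cases hW : Flippable W.1 z
  · by_cases hzV : (z : Point) ∈ V.1 <;> by_cases hzW : (z : Point) ∈ W.1
    · exact add_le_add (hf hVW) (hf (flipState_le_flipState hVW hV hW (by simp [hzV, hzW])))
    · exact absurd (hVW hzV) hzW
    · rw [add_comm (f W)]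
      exact add_le_add (hf (le_flipState_of_notMem hVW hzV)) (hf (flipState_le_of_mem hVW hzW))
    · exact add_le_add (hf hVW) (hf (flipState_le_flipState hVW hV hW (by simp [hzV, hzW])))
  · rw [flipState_of_not_flippable hW]
    have hzW : (z : Point) ∈ W.1 := by
      by_contra hzW
      exact hW ⟨fun y hy => hVW (hV.1 y hy), fun y hy hyW => hzW (W.1.lower hy.le hyW)⟩
    exact add_le_add (hf hVW) (hf (flipState_le_of_mem hVW hzW))
  · rw [flipState_of_not_flippable hV]
    have hzV : (z : Point) ∉ V.1 := fun hzV =>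
      hV ⟨fun y hy => V.1.lower hy.le hzV, fun y hy hyV => hW.2 y hy (hVW hyV)⟩
    exact add_le_add (hf hVW) (hf (le_flipState_of_notMem hVW hzV))
  · rw [flipState_of_not_flippable hV, flipState_of_not_flippable hW]
    exact add_le_add (hf hVW) (hf hVW)

end StateFlips

/-! ### Spectral gap of the reflected walk on an interval -/

section ReflectingWalk

open Finset

/-- Summation by parts; reflection leaves no boundary terms. -/
theorem sum_range_reflecting_laplacian (r : ℕ → ℝ) (m : ℕ) (w : ℕ → ℝ) :
    ∑ j ∈ range (m + 1), w j * ((if j < m then (r (j + 1) - r j) / 2 else 0) +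
      (if 0 < j then (r (j - 1) - r j) / 2 else 0)) =
      -(1 / 2) * ∑ j ∈ range m, (w (j + 1) - w j) * (r (j + 1) - r j) := by
  simp only [mul_add, sum_add_distrib]
  rw [sum_range_succ, sum_range_succ' (fun j => w j * if 0 < j then (r (j - 1) - r j) / 2 else 0)]
  simp only [lt_irrefl, if_false, mul_zero, add_zero, Nat.succ_pos, if_true, Nat.add_sub_cancel]
  rw [mul_sum, ← sum_add_distrib]
  refine sum_congr rfl fun j hj => ?_
  rw [if_pos (mem_range.1 hj)]
  ring

theorem sq_sub_le_card_mul_sum (r : ℕ → ℝ) {m i j : ℕ} (hij : i ≤ j) (hj : j ≤ m) :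
    (r j - r i) ^ 2 ≤ m * ∑ k ∈ range m, (r (k + 1) - r k) ^ 2 := by
  have h1 : r j - r i = ∑ k ∈ Ico i j, (r (k + 1) - r k) := (sum_Ico_sub r hij).symm
  rw [h1]
  refine (sq_sum_le_card_mul_sum_sq).trans ?_
  have hsub : Ico i j ⊆ range m := fun k hk => mem_range.2 ((mem_Ico.1 hk).2.trans_le hj)
  gcongr
  rw [Nat.card_Ico]
  omega

/-- With mean zero, the double sum of `(r j - r i) ^ 2` equals `2 (m + 1) ∑ r²`, while
Cauchy–Schwarz along the path from `i` to `j` bounds each of its terms. -/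
theorem poincare_range (r : ℕ → ℝ) (m : ℕ) (h0 : ∑ j ∈ range (m + 1), r j = 0) :
    2 * ∑ j ∈ range (m + 1), r j ^ 2 ≤
      (m + 1 : ℝ) ^ 2 * ∑ k ∈ range m, (r (k + 1) - r k) ^ 2 := by
  set G := ∑ k ∈ range m, (r (k + 1) - r k) ^ 2 with hG
  have hG0 : 0 ≤ G := sum_nonneg fun _ _ => sq_nonneg _
  have h1 : ∑ i ∈ range (m + 1), ∑ j ∈ range (m + 1), (r j - r i) ^ 2 =
      2 * (m + 1) * ∑ j ∈ range (m + 1), r j ^ 2 := by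
    have : ∀ i, ∑ j ∈ range (m + 1), (r j - r i) ^ 2 =
        ∑ j ∈ range (m + 1), r j ^ 2 + (m + 1) * r i ^ 2 := by
      intro i
      have : ∀ j, (r j - r i) ^ 2 = r j ^ 2 + r i ^ 2 - 2 * r i * r j := fun j => by ring
      simp only [this, sum_sub_distrib, sum_add_distrib, ← mul_sum, h0]
      simp
    simp only [this, sum_add_distrib, ← mul_sum]
    simp
    ring
  have h2 : ∑ i ∈ range (m + 1), ∑ j ∈ range (m + 1), (r j - r i) ^ 2 ≤
      ∑ _i ∈ range (m + 1), ∑ _j ∈ range (m + 1), (m + 1 : ℝ) * G := by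
    refine sum_le_sum fun i hi => sum_le_sum fun j hj => ?_
    have hm : (m : ℝ) * G ≤ (m + 1) * G := by nlinarith
    have hi' := Nat.lt_succ_iff.1 (mem_range.1 hi)
    have hj' := Nat.lt_succ_iff.1 (mem_range.1 hj)
    rcases le_total i j with hij | hij
    · exact (sq_sub_le_card_mul_sum r hij hj').trans hm
    · rw [← neg_sub, neg_sq]
      exact (sq_sub_le_card_mul_sum r hij hi').trans hm
  rw [h1] at h2
  simp only [sum_const, card_range, nsmul_eq_mul, Nat.cast_add, Nat.cast_one] at h2
  have hm : (0 : ℝ) < m + 1 := by positivity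
  nlinarith [le_of_mul_le_mul_left (a := (m + 1 : ℝ)) (b := 2 * ∑ j ∈ range (m + 1), r j ^ 2)
    (c := (m + 1 : ℝ) ^ 2 * G) (by nlinarith) hm]

/-- Exponential decay of mean zero solutions of the heat equation on `{0, …, m}` with reflection at
the end points. -/
theorem abs_le_of_reflecting_heat_equation (r : ℕ → ℝ → ℝ) (m : ℕ)
    (hr : ∀ j ≤ m, ∀ t, HasDerivAt (r j) ((if j < m then (r (j + 1) t - r j t) / 2 else 0) +
      (if 0 < j then (r (j - 1) t - r j t) / 2 else 0)) t)
    (h0 : ∑ j ∈ range (m + 1), r j 0 = 0) (hb : ∀ j ≤ m, |r j 0| ≤ m + 1) {t : ℝ} (ht : 0 ≤ t)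
    {j : ℕ} (hj : j ≤ m) :
    |r j t| ≤ (m + 1 : ℝ) ^ 2 * Real.exp (-(t / (m + 1 : ℝ) ^ 2)) := by
  have hr' : ∀ j ∈ range (m + 1), ∀ t, HasDerivAt (r j)
      ((if j < m then (r (j + 1) t - r j t) / 2 else 0) +
      (if 0 < j then (r (j - 1) t - r j t) / 2 else 0)) t :=
    fun j hj t => hr j (Nat.lt_succ_iff.1 (mem_range.1 hj)) t
  have hmean : ∀ s, ∑ j ∈ range (m + 1), r j s = 0 := by
    intro s
    have hd : ∀ s, HasDerivAt (fun s => ∑ j ∈ range (m + 1), r j s) 0 s := by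
      intro s
      have := HasDerivAt.fun_sum fun j hj => hr' j hj s
      refine this.congr_deriv ?_
      have h := sum_range_reflecting_laplacian (fun j => r j s) m fun _ => 1
      simp only [one_mul, sub_self, zero_mul, sum_const_zero, mul_zero] at h
      exact h
    have := is_const_of_deriv_eq_zero (fun s => (hd s).differentiableAt) (fun s => (hd s).deriv) s 0
    rw [this, h0]
  -- The energy `∑ r²` has derivative minus the sum of squared gradients, which the Poincaré
  -- inequality bounds by `-κ` times the energy.
  set κ : ℝ := 2 / (m + 1 : ℝ) ^ 2 with hκ
  have hm : (0 : ℝ) < (m + 1 : ℝ) ^ 2 := by positivity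
  have hE : ∀ s, HasDerivAt (fun s => Real.exp (κ * s) * ∑ j ∈ range (m + 1), r j s ^ 2)
      (Real.exp (κ * s) * (κ * ∑ j ∈ range (m + 1), r j s ^ 2 -
        ∑ j ∈ range m, (r (j + 1) s - r j s) ^ 2)) s := by
    intro s
    have h1 := HasDerivAt.fun_sum fun j hj => (hr' j hj s).fun_pow 2
    have h2 : HasDerivAt (fun s => Real.exp (κ * s)) (Real.exp (κ * s) * κ) s := by
      simpa using ((hasDerivAt_id s).const_mul κ).exp
    refine (h2.fun_mul h1).congr_deriv ?_
    have h := sum_range_reflecting_laplacian (fun j => r j s) m fun j => 2 * r j s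
    have h3 : ∑ j ∈ range m, (r (j + 1) s - r j s) ^ 2 =
        -(-(1 / 2) * ∑ j ∈ range m, (2 * r (j + 1) s - 2 * r j s) * (r (j + 1) s - r j s)) := by
      rw [mul_sum, ← sum_neg_distrib]
      exact sum_congr rfl fun j _ => by ring
    rw [h3, ← h]
    simp only [Nat.cast_ofNat, Nat.add_one_sub_one, pow_one]
    ring
  have hanti : Antitone fun s => Real.exp (κ * s) * ∑ j ∈ range (m + 1), r j s ^ 2 := by
    refine antitone_of_deriv_nonpos (fun s => (hE s).differentiableAt) fun s => ?_
    rw [(hE s).deriv]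
    refine mul_nonpos_of_nonneg_of_nonpos (Real.exp_pos _).le ?_
    have := poincare_range (fun j => r j s) m (hmean s)
    rw [sub_nonpos, hκ, div_mul_eq_mul_div, div_le_iff₀ hm]
    linarith
  have h1 := hanti ht
  dsimp only at h1
  rw [mul_zero, Real.exp_zero, one_mul] at h1
  have h2 : ∑ j ∈ range (m + 1), r j 0 ^ 2 ≤ (m + 1 : ℝ) ^ 3 := by
    calc ∑ j ∈ range (m + 1), r j 0 ^ 2 ≤ ∑ _j ∈ range (m + 1), (m + 1 : ℝ) ^ 2 := by
          refine sum_le_sum fun j hj => ?_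
          rw [← sq_abs]
          exact pow_le_pow_left₀ (abs_nonneg _) (hb j (Nat.lt_succ_iff.1 (mem_range.1 hj))) 2
      _ = (m + 1 : ℝ) ^ 3 := by
          simp only [sum_const, card_range, nsmul_eq_mul, Nat.cast_add, Nat.cast_one]; ring
  have h3 : r j t ^ 2 ≤ ∑ j ∈ range (m + 1), r j t ^ 2 :=
    single_le_sum (f := fun j => r j t ^ 2) (fun _ _ => sq_nonneg _)
      (mem_range.2 (Nat.lt_succ_of_le hj))
  have h4 : Real.exp (κ * t) * r j t ^ 2 ≤ (m + 1 : ℝ) ^ 4 := by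
    have h5 : (m + 1 : ℝ) ^ 3 ≤ (m + 1 : ℝ) ^ 4 :=
      pow_le_pow_right₀ (by linarith [Nat.cast_nonneg (α := ℝ) m]) (by norm_num)
    calc Real.exp (κ * t) * r j t ^ 2 ≤ _ := mul_le_mul_of_nonneg_left h3 (Real.exp_pos _).le
      _ ≤ _ := h1.trans (h2.trans h5)
  refine abs_le_of_sq_le_sq ?_ (by positivity)
  have h6 : Real.exp (-(t / (m + 1 : ℝ) ^ 2)) ^ 2 = (Real.exp (κ * t))⁻¹ := by
    rw [← Real.exp_neg, ← Real.exp_nat_mul, hκ]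
    congr 1
    push_cast
    ring
  rw [mul_pow, h6, ← div_eq_mul_inv, le_div_iff₀ (Real.exp_pos _)]
  linarith [h4, show ((m + 1 : ℝ) ^ 2) ^ 2 = (m + 1 : ℝ) ^ 4 by ring]

end ReflectingWalk

/-! ### Integer coordinates and the local criterion for a flip -/

section Coordinates

/-- The coordinates of a point, as integers. -/
def coord (p : Point) (i : Fin 3) : ℤ := ((p i : ℕ) : ℤ)

theorem coord_pos (p : Point) (i : Fin 3) : 0 < coord p i := by
  simp [coord]

theorem point_le_iff {p q : Point} :
    p ≤ q ↔ coord p 0 ≤ coord q 0 ∧ coord p 1 ≤ coord q 1 ∧ coord p 2 ≤ coord q 2 := by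
  simp [Pi.le_def, Fin.forall_fin_succ, coord]

theorem point_ext {p q : Point} (h0 : coord p 0 = coord q 0) (h1 : coord p 1 = coord q 1)
    (h2 : coord p 2 = coord q 2) : p = q :=
  le_antisymm (point_le_iff.2 ⟨h0.le, h1.le, h2.le⟩) (point_le_iff.2 ⟨h0.ge, h1.ge, h2.ge⟩)

theorem exists_point {a b c : ℤ} (ha : 0 < a) (hb : 0 < b) (hc : 0 < c) :
    ∃ p : Point, coord p 0 = a ∧ coord p 1 = b ∧ coord p 2 = c := by
  refine ⟨![⟨a.toNat, by omega⟩, ⟨b.toNat, by omega⟩, ⟨c.toNat, by omega⟩], ?_, ?_, ?_⟩ <;>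
    simp [coord] <;> omega

/-- Membership in `V` of the point with integer coordinates `a`, `b`, `c`; by convention it holds
when some coordinate is not positive. -/
def HasCube (V : PositiveMonotoneSet) (a b c : ℤ) : Prop :=
  ∀ p : Point, coord p 0 = a → coord p 1 = b → coord p 2 = c → p ∈ V

theorem hasCube_coord {V : PositiveMonotoneSet} {p : Point} :
    HasCube V (coord p 0) (coord p 1) (coord p 2) ↔ p ∈ V :=
  ⟨fun h => h p rfl rfl rfl, fun h _ h0 h1 h2 => point_ext h0 h1 h2 ▸ h⟩

theorem HasCube.anti {V : PositiveMonotoneSet} {a b c a' b' c' : ℤ} (h : HasCube V a' b' c')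
    (ha : a ≤ a') (hb : b ≤ b') (hc : c ≤ c') : HasCube V a b c := by
  rintro p rfl rfl rfl
  obtain ⟨q, hq0, hq1, hq2⟩ := exists_point ((coord_pos p 0).trans_le ha)
    ((coord_pos p 1).trans_le hb) ((coord_pos p 2).trans_le hc)
  exact V.lower (point_le_iff.2 ⟨hq0 ▸ ha, hq1 ▸ hb, hq2 ▸ hc⟩) (h q hq0 hq1 hq2)

theorem HasCube.mono {V W : PositiveMonotoneSet} (hVW : V ≤ W) {a b c : ℤ} (h : HasCube V a b c) :
    HasCube W a b c :=
  fun p h0 h1 h2 => hVW (h p h0 h1 h2)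

theorem hasCube_congr {V W : PositiveMonotoneSet} {a b c : ℤ}
    (h : ∀ p : Point, coord p 0 = a → coord p 1 = b → (p ∈ V ↔ p ∈ W)) :
    HasCube V a b c ↔ HasCube W a b c :=
  ⟨fun hV p h0 h1 h2 => (h p h0 h1).1 (hV p h0 h1 h2),
    fun hW p h0 h1 h2 => (h p h0 h1).2 (hW p h0 h1 h2)⟩

theorem flippable_iff_hasCube {V : PositiveMonotoneSet} {z : Point} {x y k : ℤ}
    (hx : coord z 0 = x) (hy : coord z 1 = y) (hk : coord z 2 = k) :
    Flippable V z ↔ (HasCube V (x - 1) y k ∧ HasCube V x (y - 1) k ∧ HasCube V x y (k - 1)) ∧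
      ¬HasCube V (x + 1) y k ∧ ¬HasCube V x (y + 1) k ∧ ¬HasCube V x y (k + 1) := by
  have hx0 := coord_pos z 0
  have hy0 := coord_pos z 1
  have hk0 := coord_pos z 2
  have hlt : ∀ p q : Point, p < q ↔ p ≤ q ∧
      ¬(coord q 0 ≤ coord p 0 ∧ coord q 1 ≤ coord p 1 ∧ coord q 2 ≤ coord p 2) := fun p q => by
    rw [lt_iff_le_not_ge, point_le_iff (p := q)]
  subst hx hy hk
  constructor
  · rintro ⟨h1, h2⟩
    have key : ∀ p : Point, coord p 0 ≤ coord z 0 → coord p 1 ≤ coord z 1 →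
        coord p 2 ≤ coord z 2 →
        coord p 0 + coord p 1 + coord p 2 < coord z 0 + coord z 1 + coord z 2 → p ∈ V := by
      intro p h0 h1' h2' hs
      refine h1 p ((hlt p z).2 ⟨point_le_iff.2 ⟨h0, h1', h2'⟩, fun h => by omega⟩)
    have key2 : ∀ a b c : ℤ, coord z 0 ≤ a → coord z 1 ≤ b → coord z 2 ≤ c →
        coord z 0 + coord z 1 + coord z 2 < a + b + c → ¬HasCube V a b c := by
      intro a b c ha hb hc hs hV
      obtain ⟨q, hq0, hq1, hq2⟩ := exists_point (hx0.trans_le ha) (hy0.trans_le hb) (hk0.trans_le hc)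
      exact h2 q ((hlt z q).2 ⟨point_le_iff.2 ⟨by omega, by omega, by omega⟩, fun h => by omega⟩)
        (hV q hq0 hq1 hq2)
    refine ⟨⟨?_, ?_, ?_⟩, ?_, ?_, ?_⟩
    · intro p e0 e1 e2; exact key p (by omega) (by omega) (by omega) (by omega)
    · intro p e0 e1 e2; exact key p (by omega) (by omega) (by omega) (by omega)
    · intro p e0 e1 e2; exact key p (by omega) (by omega) (by omega) (by omega)
    · exact key2 _ _ _ (by omega) (by omega) (by omega) (by omega)
    · exact key2 _ _ _ (by omega) (by omega) (by omega) (by omega)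
    · exact key2 _ _ _ (by omega) (by omega) (by omega) (by omega)
  · rintro ⟨⟨h1, h2, h3⟩, h4, h5, h6⟩
    constructor
    · intro p hp
      obtain ⟨hle, hne⟩ := (hlt p z).1 hp
      obtain ⟨e0, e1, e2⟩ := point_le_iff.1 hle
      rw [← hasCube_coord]
      by_cases c0 : coord p 0 ≤ coord z 0 - 1
      · exact h1.anti c0 e1 e2
      by_cases c1 : coord p 1 ≤ coord z 1 - 1
      · exact h2.anti e0 c1 e2
      · exact h3.anti e0 e1 (by omega)
    · intro p hp hpV
      obtain ⟨hle, hne⟩ := (hlt z p).1 hp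
      obtain ⟨e0, e1, e2⟩ := point_le_iff.1 hle
      rw [← hasCube_coord] at hpV
      by_cases c0 : coord z 0 + 1 ≤ coord p 0
      · exact h4 (hpV.anti c0 e1 e2)
      by_cases c1 : coord z 1 + 1 ≤ coord p 1
      · exact h5 (hpV.anti e0 c1 e2)
      · exact h6 (hpV.anti e0 e1 (by omega))

end Coordinates

/-! ### Columns: height, floor and ceiling -/

section Columns

variable (Vm Vp : PositiveMonotoneSet)

/-- The point with integer coordinates `a`, `b`, `c` lies in the region. -/
def InRegion (a b c : ℤ) : Prop := HasCube Vp a b c ∧ ¬HasCube Vm a b c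

variable {Vm Vp}

theorem inRegion_iff {a b c : ℤ} : InRegion Vm Vp a b c ↔
    ∃ z : region Vm Vp, coord z 0 = a ∧ coord z 1 = b ∧ coord z 2 = c := by
  constructor
  · rintro ⟨h1, h2⟩
    simp only [HasCube, not_forall] at h2
    obtain ⟨p, h0', h1', h2', hp⟩ := h2
    exact ⟨⟨p, h1 p h0' h1' h2', hp⟩, h0', h1', h2'⟩
  · rintro ⟨z, rfl, rfl, rfl⟩
    exact ⟨hasCube_coord.2 z.2.1, fun h => z.2.2 (hasCube_coord.1 h)⟩

theorem InRegion.of_between {a b c a' b' c' a'' b'' c'' : ℤ} (h : InRegion Vm Vp a b c)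
    (h' : InRegion Vm Vp a'' b'' c'') (ha : a ≤ a') (ha' : a' ≤ a'') (hb : b ≤ b') (hb' : b' ≤ b'')
    (hc : c ≤ c') (hc' : c' ≤ c'') : InRegion Vm Vp a' b' c' :=
  ⟨h'.1.anti ha' hb' hc', fun hh => h.2 (hh.anti ha hb hc)⟩

theorem hasCube_iff_of_not_inRegion {a b c : ℤ} (h : ¬InRegion Vm Vp a b c) (V W : State Vm Vp) :
    HasCube V.1 a b c ↔ HasCube W.1 a b c := by
  by_cases hm : HasCube Vm a b c
  · exact iff_of_true (hm.mono V.2.1) (hm.mono W.2.1)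
  · have hp : ¬HasCube Vp a b c := fun hp => h ⟨hp, hm⟩
    exact iff_of_false (fun hh => hp (hh.mono V.2.2)) fun hh => hp (hh.mono W.2.2)

variable [Finite (region Vm Vp)]

variable (Vm Vp) in
open Classical in
/-- The heights of the sites of the region in a vertical column. -/
noncomputable def column (x y : ℤ) : Finset ℤ :=
  ({z : region Vm Vp | coord z 0 = x ∧ coord z 1 = y} : Finset (region Vm Vp)).image
    fun z => coord z 2

theorem mem_column {x y k : ℤ} : k ∈ column Vm Vp x y ↔ InRegion Vm Vp x y k := by
  simp [column, inRegion_iff, and_assoc]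

open Classical in
/-- The number of sites of a column that belong to `V`. -/
noncomputable def colHeight (x y : ℤ) (V : State Vm Vp) : ℕ :=
  ((column Vm Vp x y).filter fun k => HasCube V.1 x y k).card

open Classical in
/-- The smallest height that a column may have, given the other columns of `V`. -/
noncomputable def colFloor (x y : ℤ) (V : State Vm Vp) : ℕ :=
  ((column Vm Vp x y).filter fun k => HasCube V.1 (x + 1) y k ∨ HasCube V.1 x (y + 1) k).card

open Classical in
/-- The largest height that a column may have, given the other columns of `V`. -/
noncomputable def colCeil (x y : ℤ) (V : State Vm Vp) : ℕ :=
  ((column Vm Vp x y).filter fun k => HasCube V.1 (x - 1) y k ∧ HasCube V.1 x (y - 1) k).card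

theorem colFloor_le_colHeight (x y : ℤ) (V : State Vm Vp) : colFloor x y V ≤ colHeight x y V := by
  classical
  refine Finset.card_le_card (Finset.monotone_filter_right _ ?_)
  rintro k _ (h | h)
  · exact h.anti (by omega) le_rfl le_rfl
  · exact h.anti le_rfl (by omega) le_rfl

theorem colHeight_le_colCeil (x y : ℤ) (V : State Vm Vp) : colHeight x y V ≤ colCeil x y V := by
  classical
  refine Finset.card_le_card (Finset.monotone_filter_right _ ?_)
  intro k _ h
  exact ⟨h.anti (by omega) le_rfl le_rfl, h.anti le_rfl (by omega) le_rfl⟩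

theorem colCeil_le_card (x y : ℤ) (V : State Vm Vp) :
    colCeil x y V ≤ (column Vm Vp x y).card := by
  classical
  exact Finset.card_filter_le _ _

/-- On an interval a downward closed predicate is an initial segment, hence determined by its number
of elements. This turns membership into inequalities between integers. -/
theorem iff_le_add_card_filter {β T : ℤ} (p : ℤ → Prop) [DecidablePred p]
    (hp : ∀ k k', k ≤ k' → p k' → p k) {k : ℤ} (hk : k ∈ Finset.Ioc β T) :
    p k ↔ k ≤ β + ((Finset.Ioc β T).filter p).card := by
  rw [Finset.mem_Ioc] at hk
  constructor
  · intro h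
    have hs : Finset.Ioc β k ⊆ (Finset.Ioc β T).filter p := by
      intro j hj
      rw [Finset.mem_Ioc] at hj
      exact Finset.mem_filter.2 ⟨Finset.mem_Ioc.2 ⟨hj.1, hj.2.trans hk.2⟩, hp j k hj.2 h⟩
    have := Finset.card_le_card hs
    rw [Int.card_Ioc] at this
    omega
  · intro h
    by_contra hpk
    have hs : (Finset.Ioc β T).filter p ⊆ Finset.Ioc β (k - 1) := by
      intro j hj
      rw [Finset.mem_filter, Finset.mem_Ioc] at hj
      rw [Finset.mem_Ioc]
      refine ⟨hj.1.1, ?_⟩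
      by_contra hjk
      exact hpk (hp k j (by omega) hj.2)
    have := Finset.card_le_card hs
    rw [Int.card_Ioc] at this
    omega

theorem exists_column_eq_Ioc {x y : ℤ} (h : (column Vm Vp x y).Nonempty) :
    ∃ β T : ℤ, β < T ∧ column Vm Vp x y = Finset.Ioc β T := by
  refine ⟨(column Vm Vp x y).min' h - 1, (column Vm Vp x y).max' h, ?_, ?_⟩
  · have := Finset.min'_le_max' _ h
    omega
  · ext k
    rw [Finset.mem_Ioc]
    constructor
    · intro hk
      have h1 := Finset.min'_le _ k hk
      have h2 := Finset.le_max' _ k hk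
      omega
    · rintro ⟨h1, h2⟩
      exact mem_column.2 ((mem_column.1 (Finset.min'_mem _ h)).of_between
        (mem_column.1 (Finset.max'_mem _ h)) le_rfl le_rfl le_rfl le_rfl (by omega) h2)

section SingleColumn

variable {x y β T : ℤ} (hβT : β < T) (hcol : column Vm Vp x y = Finset.Ioc β T)

include hβT hcol

theorem column_coords_pos : 0 < x ∧ 0 < y ∧ 0 ≤ β := by
  have h : β + 1 ∈ column Vm Vp x y := by rw [hcol, Finset.mem_Ioc]; omega
  obtain ⟨z, h0, h1, h2⟩ := inRegion_iff.1 (mem_column.1 h)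
  have := coord_pos z 0
  have := coord_pos z 1
  have := coord_pos z 2
  omega

theorem hasCube_bottom_iff {k : ℤ} : HasCube Vm x y k ↔ k ≤ β := by
  have hβ : ¬InRegion Vm Vp x y β := by
    rw [← mem_column, hcol, Finset.mem_Ioc]; omega
  have hT : InRegion Vm Vp x y T := by
    rw [← mem_column, hcol, Finset.mem_Ioc]; omega
  have hβ1 : InRegion Vm Vp x y (β + 1) := by
    rw [← mem_column, hcol, Finset.mem_Ioc]; omega
  constructor
  · intro h
    by_contra hk
    exact hβ1.2 (h.anti le_rfl le_rfl (by omega))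
  · intro hk
    by_contra h
    exact hβ ⟨hT.1.anti le_rfl le_rfl hβT.le, fun hh => h (hh.anti le_rfl le_rfl hk)⟩

theorem hasCube_top_iff {k : ℤ} : HasCube Vp x y k ↔ k ≤ T := by
  have hT1 : ¬InRegion Vm Vp x y (T + 1) := by
    rw [← mem_column, hcol, Finset.mem_Ioc]; omega
  have hT : InRegion Vm Vp x y T := by
    rw [← mem_column, hcol, Finset.mem_Ioc]; omega
  constructor
  · intro h
    by_contra hk
    refine hT1 ⟨h.anti le_rfl le_rfl (by omega), fun hh => ?_⟩
    have := (hasCube_bottom_iff hβT hcol).1 hh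
    omega
  · intro hk
    exact hT.1.anti le_rfl le_rfl hk

theorem hasCube_iff_le_colHeight (V : State Vm Vp) {k : ℤ} :
    HasCube V.1 x y k ↔ k ≤ β + colHeight x y V := by
  classical
  have hle : (colHeight x y V : ℤ) ≤ T - β := by
    have := (colHeight_le_colCeil x y V).trans (colCeil_le_card x y V)
    rw [hcol, Int.card_Ioc] at this
    omega
  by_cases hk : k ∈ Finset.Ioc β T
  · rw [colHeight, hcol]
    exact iff_le_add_card_filter (fun k => HasCube V.1 x y k)
      (fun a b hab h => h.anti le_rfl le_rfl hab) hk
  · rw [Finset.mem_Ioc] at hk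
    by_cases hk1 : k ≤ β
    · exact iff_of_true (((hasCube_bottom_iff hβT hcol).2 hk1).mono V.2.1) (by omega)
    · refine iff_of_false (fun h => ?_) (by omega)
      have := (hasCube_top_iff hβT hcol).1 (h.mono V.2.2)
      omega

omit hβT in
theorem floor_iff (V : State Vm Vp) {k : ℤ} (hk : β < k) (hk' : k ≤ T) :
    (HasCube V.1 (x + 1) y k ∨ HasCube V.1 x (y + 1) k) ↔ k ≤ β + colFloor x y V := by
  classical
  rw [colFloor, hcol]
  exact iff_le_add_card_filter (fun k => HasCube V.1 (x + 1) y k ∨ HasCube V.1 x (y + 1) k)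
    (fun a b hab h => h.imp (fun h => h.anti le_rfl le_rfl hab) fun h => h.anti le_rfl le_rfl hab)
    (Finset.mem_Ioc.2 ⟨hk, hk'⟩)

omit hβT in
theorem ceil_iff (V : State Vm Vp) {k : ℤ} (hk : β < k) (hk' : k ≤ T) :
    (HasCube V.1 (x - 1) y k ∧ HasCube V.1 x (y - 1) k) ↔ k ≤ β + colCeil x y V := by
  classical
  rw [colCeil, hcol]
  exact iff_le_add_card_filter (fun k => HasCube V.1 (x - 1) y k ∧ HasCube V.1 x (y - 1) k)
    (fun a b hab h => h.imp (fun h => h.anti le_rfl le_rfl hab) fun h => h.anti le_rfl le_rfl hab)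
    (Finset.mem_Ioc.2 ⟨hk, hk'⟩)

omit hβT in
theorem add_colCeil_le (V : State Vm Vp) : (colCeil x y V : ℤ) ≤ (T - β).toNat := by
  have := colCeil_le_card x y V
  rw [hcol, Int.card_Ioc] at this
  exact_mod_cast this

/-- Points of `V` in columns further out force the column up to its floor only, and the columns
further in support it up to its ceiling. The intermediate heights are thus all compatible with the
lower set property. -/
theorem exists_state_with_colHeight (V : State Vm Vp) {j : ℕ} (hj : colFloor x y V ≤ j)
    (hj' : j ≤ colCeil x y V) :
    ∃ W : State Vm Vp, ∀ p : Point, p ∈ W.1 ↔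
      (coord p 0 = x ∧ coord p 1 = y ∧ coord p 2 ≤ β + j) ∨
      (¬(coord p 0 = x ∧ coord p 1 = y) ∧ p ∈ V.1) := by
  have hc := add_colCeil_le hcol V
  have hxy := column_coords_pos hβT hcol
  have hj2 : (colFloor x y V : ℤ) ≤ j := by exact_mod_cast hj
  have hj3 : (j : ℤ) ≤ colCeil x y V := by exact_mod_cast hj'
  refine ⟨⟨⟨{p | (coord p 0 = x ∧ coord p 1 = y ∧ coord p 2 ≤ β + j) ∨
      (¬(coord p 0 = x ∧ coord p 1 = y) ∧ p ∈ V.1)}, ?_⟩, ?_, ?_⟩, fun p => Iff.rfl⟩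
  · intro p q hqp hp
    obtain ⟨e0, e1, e2⟩ := point_le_iff.1 hqp
    simp only [Set.mem_ofPred_eq] at hp ⊢
    by_cases hq : coord q 0 = x ∧ coord q 1 = y
    · refine Or.inl ⟨hq.1, hq.2, ?_⟩
      rcases hp with ⟨_, _, hp2⟩ | ⟨hpc, hpV⟩
      · omega
      · by_contra hlt
        rw [← hasCube_coord] at hpV
        have hqT : coord q 2 ≤ T := (hasCube_top_iff hβT hcol).1
          ((hpV.mono V.2.2).anti (by omega) (by omega) e2)
        have hfl : coord q 2 ≤ β + colFloor x y V := by
          refine (floor_iff hcol V (by omega) hqT).1 ?_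
          by_cases h0 : coord p 0 = x
          · exact Or.inr (hpV.anti (by omega) (by omega) e2)
          · exact Or.inl (hpV.anti (by omega) (by omega) e2)
        omega
    · refine Or.inr ⟨hq, ?_⟩
      rcases hp with ⟨hp0, hp1, hp2⟩ | ⟨_, hpV⟩
      · rw [← hasCube_coord]
        by_cases hk : coord p 2 ≤ β
        · have := ((hasCube_bottom_iff hβT hcol).2 hk).mono V.2.1
          exact this.anti (by omega) (by omega) e2
        · have := (ceil_iff hcol V (k := coord p 2) (by omega) (by omega)).2 (by omega)
          by_cases h0 : coord q 0 = x
          · exact this.2.anti (by omega) (by omega) e2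
          · exact this.1.anti (by omega) (by omega) e2
      · exact V.1.lower hqp hpV
  · intro p hp
    by_cases hpc : coord p 0 = x ∧ coord p 1 = y
    · refine Or.inl ⟨hpc.1, hpc.2, ?_⟩
      have h := hasCube_coord.2 hp
      rw [hpc.1, hpc.2, hasCube_bottom_iff hβT hcol] at h
      omega
    · exact Or.inr ⟨hpc, V.2.1 hp⟩
  · rintro p (⟨h0, h1, h2⟩ | ⟨_, hpV⟩)
    · have : HasCube Vp (coord p 0) (coord p 1) (coord p 2) := by
        rw [h0, h1, hasCube_top_iff hβT hcol]
        omega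
      exact hasCube_coord.1 this
    · exact V.2.2 hpV

end SingleColumn

end Columns

/-! ### One column under the dynamics of one parity -/

section ColumnDynamics

open scoped Matrix

variable {Vm Vp : PositiveMonotoneSet}

/-- `W` is obtained from `V` by setting the height of a column to `n`. -/
def IsColumnModification (x y n : ℤ) (V W : State Vm Vp) : Prop :=
  ∀ p : Point, p ∈ W.1 ↔ (coord p 0 = x ∧ coord p 1 = y ∧ coord p 2 ≤ n) ∨
    (¬(coord p 0 = x ∧ coord p 1 = y) ∧ p ∈ V.1)

theorem IsColumnModification.unique {x y n : ℤ} {V W W' : State Vm Vp}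
    (h : IsColumnModification x y n V W) (h' : IsColumnModification x y n V W') : W = W' :=
  State.ext_mem fun p => (h p).trans (h' p).symm

theorem IsColumnModification.hasCube_iff_of_ne {x y n a b c : ℤ} {V W : State Vm Vp}
    (h : IsColumnModification x y n V W) (hab : ¬(a = x ∧ b = y)) :
    HasCube W.1 a b c ↔ HasCube V.1 a b c :=
  hasCube_congr fun p h0 h1 => by
    have hp : ¬(coord p 0 = x ∧ coord p 1 = y) := by rwa [h0, h1]
    rw [h p]
    tauto

/-- `V` and `W` agree on a column and on all sites of the other parity. -/
def AgreeOn (e x y : ℤ) (V W : State Vm Vp) : Prop :=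
  ∀ p : Point, (¬Even (coord p 0 - coord p 1 - e) ∨ (coord p 0 = x ∧ coord p 1 = y)) →
    (p ∈ V.1 ↔ p ∈ W.1)

theorem AgreeOn.hasCube_iff {e x y a b c : ℤ} {V W : State Vm Vp} (h : AgreeOn e x y V W)
    (hab : ¬Even (a - b - e) ∨ (a = x ∧ b = y)) : HasCube V.1 a b c ↔ HasCube W.1 a b c :=
  hasCube_congr fun p h0 h1 => h p (by rwa [h0, h1])

/-- Whether a site of the column can flip depends on that column and its four neighbours, which have
the other parity; flips in other columns of the same parity are not seen by `AgreeOn`. -/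
theorem AgreeOn.flipState {e x y : ℤ} {V W : State Vm Vp} (h : AgreeOn e x y V W)
    (hxy : Even (x - y - e)) {z : region Vm Vp} (hz : Even (coord z 0 - coord z 1 - e)) :
    AgreeOn e x y (flipState z V) (flipState z W) := by
  intro p hp
  by_cases hpz : p = z
  · have hzc : coord z 0 = x ∧ coord z 1 = y := by
      subst hpz
      exact hp.resolve_left (not_not.2 hz)
    have h1 : ¬Even (x - 1 - y - e) := by rw [Int.even_iff] at *; omega
    have h2 : ¬Even (x - (y - 1) - e) := by rw [Int.even_iff] at *; omega
    have h3 : ¬Even (x + 1 - y - e) := by rw [Int.even_iff] at *; omega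
    have h4 : ¬Even (x - (y + 1) - e) := by rw [Int.even_iff] at *; omega
    have hfl : Flippable V.1 z ↔ Flippable W.1 z := by
      rw [flippable_iff_hasCube hzc.1 hzc.2 rfl, flippable_iff_hasCube hzc.1 hzc.2 rfl,
        h.hasCube_iff (Or.inl h1), h.hasCube_iff (Or.inl h2), h.hasCube_iff (Or.inl h3),
        h.hasCube_iff (Or.inl h4), h.hasCube_iff (c := coord z 2 - 1) (Or.inr ⟨rfl, rfl⟩),
        h.hasCube_iff (c := coord z 2 + 1) (Or.inr ⟨rfl, rfl⟩)]
    by_cases hV : Flippable V.1 z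
    · rw [hpz, mem_flipState_self hV, mem_flipState_self (hfl.1 hV)]
      exact not_congr (h z (Or.inr hzc))
    · rw [flipState_of_not_flippable hV, flipState_of_not_flippable fun hW => hV (hfl.2 hW)]
      exact h p hp
  · rw [mem_flipState_of_ne z V hpz, mem_flipState_of_ne z W hpz]
    exact h p hp

theorem agreeOn_flipState_self {e x y : ℤ} (V : State Vm Vp) {z : region Vm Vp}
    (hz : Even (coord z 0 - coord z 1 - e)) (hzc : ¬(coord z 0 = x ∧ coord z 1 = y)) :
    AgreeOn e x y (flipState z V) V := by
  intro p hp
  refine mem_flipState_of_ne z V ?_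
  rintro rfl
  exact hp.elim (fun h => h hz) hzc

variable [Finite (region Vm Vp)]

variable (Vm Vp) in
open Classical in
/-- The sites whose diagonal has the parity of `e`. -/
noncomputable def paritySites (e : ℤ) : Finset (region Vm Vp) :=
  {z : region Vm Vp | Even (coord z 0 - coord z 1 - e)}

theorem mem_paritySites {e : ℤ} {z : region Vm Vp} :
    z ∈ paritySites Vm Vp e ↔ Even (coord z 0 - coord z 1 - e) := by
  simp [paritySites]

variable (Vm Vp) in
/-- The generator that only updates the sites whose diagonal has the parity of `e`. -/
noncomputable def parityGenerator (e : ℤ) : Matrix (State Vm Vp) (State Vm Vp) ℝ :=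
  flipGenerator (fun z : region Vm Vp => siteUpdate Vm Vp z) (paritySites Vm Vp e)

theorem parityGenerator_mulVec_apply (e : ℤ) (f : State Vm Vp → ℝ) (V : State Vm Vp) :
    (parityGenerator Vm Vp e *ᵥ f) V =
      ∑ z ∈ paritySites Vm Vp e, (f (flipState z V) - f V) / 2 :=
  flipGenerator_mulVec_apply isMonotoneFlip_siteUpdate _ f V

/-- Functions of the sites of one column and of all sites of the other parity. -/
def columnFunctions (Vm Vp : PositiveMonotoneSet) (e x y : ℤ) : Set (State Vm Vp → ℝ) :=
  {f | ∀ V W, AgreeOn e x y V W → f V = f W}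

theorem exp_parityGenerator_mulVec_mem_columnFunctions {e x y : ℤ} (hxy : Even (x - y - e)) (t : ℝ)
    {f : State Vm Vp → ℝ} (hf : f ∈ columnFunctions Vm Vp e x y) :
    NormedSpace.exp (t • parityGenerator Vm Vp e) *ᵥ f ∈ columnFunctions Vm Vp e x y := by
  have hclosed : IsClosed (columnFunctions Vm Vp e x y) := by
    have : columnFunctions Vm Vp e x y =
        ⋂ V, ⋂ W, ⋂ _ : AgreeOn e x y V W, {f : State Vm Vp → ℝ | f V = f W} := by
      ext f; simp [columnFunctions]
    rw [this]
    exact isClosed_iInter fun V => isClosed_iInter fun W => isClosed_iInter fun _ =>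
      isClosed_eq (continuous_apply V) (continuous_apply W)
  have hzero : (0 : State Vm Vp → ℝ) ∈ columnFunctions Vm Vp e x y := fun _ _ _ => rfl
  have hadd : ∀ f ∈ columnFunctions Vm Vp e x y, ∀ g ∈ columnFunctions Vm Vp e x y,
      f + g ∈ columnFunctions Vm Vp e x y := fun f hf g hg V W hVW => by
    rw [Pi.add_apply, Pi.add_apply, hf V W hVW, hg V W hVW]
  have hsmul : ∀ a : ℝ, 0 ≤ a → ∀ f ∈ columnFunctions Vm Vp e x y,
      a • f ∈ columnFunctions Vm Vp e x y := fun a _ f hf V W hVW => by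
    rw [Pi.smul_apply, Pi.smul_apply, hf V W hVW]
  have hL : ∀ f ∈ columnFunctions Vm Vp e x y,
      parityGenerator Vm Vp e *ᵥ f ∈ columnFunctions Vm Vp e x y := fun f hf V W hVW => by
    rw [parityGenerator_mulVec_apply, parityGenerator_mulVec_apply]
    refine Finset.sum_congr rfl fun z hz => ?_
    rw [hf V W hVW, hf _ _ (hVW.flipState hxy (mem_paritySites.1 hz))]
  -- The heat equation is used at all real times. These functions form a subspace, so a negative
  -- time is a positive time for the opposite generator.
  rcases le_total 0 t with ht | ht
  · exact exp_smul_mulVec_mem hclosed hzero hadd hsmul hL ht hf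
  · rw [← neg_smul_neg]
    refine exp_smul_mulVec_mem hclosed hzero hadd hsmul (fun f hf V W hVW => ?_)
      (neg_nonneg.2 ht) hf
    rw [Matrix.neg_mulVec, Pi.neg_apply, Pi.neg_apply, hL f hf V W hVW]

theorem colHeight_mem_columnFunctions (e x y : ℤ) :
    (fun V : State Vm Vp => (colHeight x y V : ℝ)) ∈ columnFunctions Vm Vp e x y := by
  classical
  intro V W hVW
  have : colHeight x y V = colHeight x y W := by
    rw [colHeight, colHeight]
    exact congrArg Finset.card (Finset.filter_congr fun k _ => hVW.hasCube_iff (Or.inr ⟨rfl, rfl⟩))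
  simp only [this]

theorem sum_paritySites_ite {e x y k : ℤ} (hxy : Even (x - y - e)) (a : ℝ)
    (ha : a ≠ 0 → InRegion Vm Vp x y k) :
    ∑ z ∈ paritySites Vm Vp e,
      (if coord z 0 = x ∧ coord z 1 = y ∧ coord z 2 = k then a else 0) = a := by
  by_cases h0 : a = 0
  · simp [h0]
  obtain ⟨z, hz0, hz1, hz2⟩ := inRegion_iff.1 (ha h0)
  rw [Finset.sum_eq_single z]
  · rw [if_pos ⟨hz0, hz1, hz2⟩]
  · intro w _ hw
    refine if_neg fun h => hw (Subtype.ext (point_ext ?_ ?_ ?_)) <;> omega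
  · intro hz
    exact absurd (mem_paritySites.2 (by rwa [hz0, hz1])) hz

section SingleColumn

variable {x y β T : ℤ} (hβT : β < T) (hcol : column Vm Vp x y = Finset.Ioc β T)

include hβT hcol

theorem isColumnModification_self (V : State Vm Vp) :
    IsColumnModification x y (β + colHeight x y V) V V := by
  intro p
  by_cases hp : coord p 0 = x ∧ coord p 1 = y
  · have h := hasCube_iff_le_colHeight hβT hcol V (k := coord p 2)
    rw [← hp.1, ← hp.2, hasCube_coord] at h
    rw [h]
    simp [hp.1, hp.2]
  · tauto

omit hβT hcol in
theorem IsColumnModification.colFloor_eq {n : ℤ} {V W : State Vm Vp}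
    (h : IsColumnModification x y n V W) : colFloor x y W = colFloor x y V := by
  classical
  rw [colFloor, colFloor]
  exact congrArg Finset.card (Finset.filter_congr fun k _ =>
    or_congr (h.hasCube_iff_of_ne (by omega)) (h.hasCube_iff_of_ne (by omega)))

omit hβT hcol in
theorem IsColumnModification.colCeil_eq {n : ℤ} {V W : State Vm Vp}
    (h : IsColumnModification x y n V W) : colCeil x y W = colCeil x y V := by
  classical
  rw [colCeil, colCeil]
  exact congrArg Finset.card (Finset.filter_congr fun k _ =>
    and_congr (h.hasCube_iff_of_ne (by omega)) (h.hasCube_iff_of_ne (by omega)))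

theorem IsColumnModification.hasCube_iff {V W : State Vm Vp} {j : ℕ}
    (h : IsColumnModification x y (β + j) V W) {k : ℤ} : HasCube W.1 x y k ↔ k ≤ β + j := by
  obtain ⟨hx, hy, hβ⟩ := column_coords_pos hβT hcol
  constructor
  · intro hW
    by_contra hk
    obtain ⟨p, h0, h1, h2⟩ := exists_point hx hy (c := k) (by omega)
    rcases (h p).1 (hW p h0 h1 h2) with hp | hp
    · omega
    · exact hp.1 ⟨h0, h1⟩
  · intro hk p h0 h1 h2
    exact (h p).2 (Or.inl ⟨h0, h1, by omega⟩)

theorem IsColumnModification.colHeight_eq {V W : State Vm Vp} {j : ℕ}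
    (h : IsColumnModification x y (β + j) V W) : colHeight x y W = j := by
  have h1 : ∀ k : ℤ, k ≤ β + colHeight x y W ↔ k ≤ β + j := fun k =>
    (hasCube_iff_le_colHeight hβT hcol W).symm.trans (h.hasCube_iff hβT hcol)
  have h2 := (h1 _).1 le_rfl
  have h3 := (h1 _).2 le_rfl
  omega

theorem IsColumnModification.flippable_iff {V W : State Vm Vp} {j : ℕ}
    (h : IsColumnModification x y (β + j) V W) {z : region Vm Vp} (h0 : coord z 0 = x)
    (h1 : coord z 1 = y) :
    Flippable W.1 z ↔ coord z 2 ≤ β + colCeil x y V ∧ β + colFloor x y V < coord z 2 ∧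
      (coord z 2 = β + j ∨ coord z 2 = β + j + 1) := by
  have hz : coord z 2 ∈ Finset.Ioc β T := by
    rw [← hcol, mem_column, inRegion_iff]
    exact ⟨z, h0, h1, rfl⟩
  rw [Finset.mem_Ioc] at hz
  have hf := floor_iff hcol W hz.1 hz.2
  have hc := ceil_iff hcol W hz.1 hz.2
  rw [h.colFloor_eq] at hf
  rw [h.colCeil_eq] at hc
  rw [flippable_iff_hasCube h0 h1 rfl, h.hasCube_iff hβT hcol, h.hasCube_iff hβT hcol]
  constructor
  · rintro ⟨⟨a1, a2, a3⟩, b1, b2, b3⟩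
    have h2 := hc.1 ⟨a1, a2⟩
    have h3 : ¬coord z 2 ≤ β + colFloor x y V := fun hh => (hf.2 hh).elim b1 b2
    omega
  · rintro ⟨c1, c2, c3⟩
    obtain ⟨a1, a2⟩ := hc.2 c1
    have hn : ¬(HasCube W.1 (x + 1) y (coord z 2) ∨ HasCube W.1 x (y + 1) (coord z 2)) :=
      fun hh => absurd (hf.1 hh) (not_le.2 c2)
    exact ⟨⟨a1, a2, by omega⟩, fun hh => hn (Or.inl hh), fun hh => hn (Or.inr hh), by omega⟩

theorem IsColumnModification.flipState_up {V W W' : State Vm Vp} {j : ℕ}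
    (h : IsColumnModification x y (β + j) V W)
    (h' : IsColumnModification x y (β + (j + 1 : ℕ)) V W') (hj : colFloor x y V ≤ j)
    (hj' : j < colCeil x y V) {z : region Vm Vp} (h0 : coord z 0 = x)
    (h1 : coord z 1 = y) (h2 : coord z 2 = β + j + 1) : flipState z W = W' := by
  have hfl : Flippable W.1 z := (h.flippable_iff hβT hcol h0 h1).2 (by omega)
  refine State.ext_mem fun p => ?_
  by_cases hp : p = z
  · subst hp
    rw [mem_flipState_self hfl, h, h', h0, h1, h2]
    push_cast
    simp
  · rw [mem_flipState_of_ne z W hp, h, h']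
    have : coord p 0 = x → coord p 1 = y → coord p 2 ≠ β + j + 1 := fun e0 e1 e2 =>
      hp (point_ext (by omega) (by omega) (by omega))
    push_cast
    refine or_congr (and_congr_right fun e0 => and_congr_right fun e1 => ?_) Iff.rfl
    have := this e0 e1
    omega

theorem IsColumnModification.flipState_down {V W W' : State Vm Vp} {j : ℕ}
    (h : IsColumnModification x y (β + j) V W)
    (h' : IsColumnModification x y (β + (j - 1 : ℕ)) V W') (hj : colFloor x y V < j)
    (hj' : j ≤ colCeil x y V) {z : region Vm Vp} (h0 : coord z 0 = x)
    (h1 : coord z 1 = y) (h2 : coord z 2 = β + j) : flipState z W = W' := by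
  obtain ⟨i, rfl⟩ : ∃ i, j = i + 1 := ⟨j - 1, by omega⟩
  rw [Nat.add_sub_cancel] at h'
  rw [← h'.flipState_up hβT hcol h (by omega) (by omega) h0 h1 (by push_cast at h2; omega)]
  exact flipState_involutive z W'

/-- On functions blind to the other columns of this parity, the generator is that of a reflected
walk with jump rate `1/2` each way: only the cube at height `β + j + 1`, which may be added, and the
cube at `β + j`, which may be removed, contribute. -/
theorem parityGenerator_mulVec_columnModification {e : ℤ} (hxy : Even (x - y - e)) {V : State Vm Vp}
    {W : ℕ → State Vm Vp}
    (hW : ∀ j, colFloor x y V ≤ j → j ≤ colCeil x y V → IsColumnModification x y (β + j) V (W j))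
    {f : State Vm Vp → ℝ} (hf : f ∈ columnFunctions Vm Vp e x y) {j : ℕ} (hj : colFloor x y V ≤ j)
    (hj' : j ≤ colCeil x y V) :
    (parityGenerator Vm Vp e *ᵥ f) (W j) =
      (if j < colCeil x y V then (f (W (j + 1)) - f (W j)) / 2 else 0) +
      (if colFloor x y V < j then (f (W (j - 1)) - f (W j)) / 2 else 0) := by
  have hcT := add_colCeil_le hcol V
  have hreg : ∀ k, β < k → k ≤ T → InRegion Vm Vp x y k := fun k h1 h2 => by
    rw [← mem_column, hcol, Finset.mem_Ioc]; exact ⟨h1, h2⟩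
  rw [parityGenerator_mulVec_apply,
    ← sum_paritySites_ite (k := β + j + 1) hxy
      (if j < colCeil x y V then (f (W (j + 1)) - f (W j)) / 2 else 0)
      (fun h => hreg _ (by omega) (by
        by_contra hh
        exact h (if_neg (by omega)))),
    ← sum_paritySites_ite (k := β + j) hxy
      (if colFloor x y V < j then (f (W (j - 1)) - f (W j)) / 2 else 0)
      (fun h => hreg _ (by
        by_contra hh
        exact h (if_neg (by omega))) (by omega)),
    ← Finset.sum_add_distrib]
  refine Finset.sum_congr rfl fun z hz => ?_
  have hWj := hW j hj hj'
  by_cases hzc : coord z 0 = x ∧ coord z 1 = y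
  · simp only [hzc.1, hzc.2, true_and]
    by_cases h1 : coord z 2 = β + j + 1
    · have h2 : ¬coord z 2 = β + j := by omega
      rw [if_pos h1, if_neg h2, add_zero]
      split_ifs with hju
      · rw [hWj.flipState_up hβT hcol (hW (j + 1) (by omega) hju) hj hju hzc.1 hzc.2 h1]
      · rw [flipState_of_not_flippable, sub_self, zero_div]
        rw [hWj.flippable_iff hβT hcol hzc.1 hzc.2]
        omega
    · rw [if_neg h1, zero_add]
      by_cases h2 : coord z 2 = β + j
      · rw [if_pos h2]
        split_ifs with hlj
        · rw [hWj.flipState_down hβT hcol (hW (j - 1) (by omega) (by omega)) hlj hj' hzc.1 hzc.2 h2]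
        · rw [flipState_of_not_flippable, sub_self, zero_div]
          rw [hWj.flippable_iff hβT hcol hzc.1 hzc.2]
          omega
      · rw [if_neg h2, flipState_of_not_flippable, sub_self, zero_div]
        rw [hWj.flippable_iff hβT hcol hzc.1 hzc.2]
        omega
  · rw [hf _ _ (agreeOn_flipState_self (W j) (mem_paritySites.1 hz) hzc), if_neg (by tauto),
      if_neg (by tauto)]
    simp

/-- As a function of the initial height of the column, the other columns being fixed, the expected
height minus the midpoint solves the reflecting heat equation. Its initial value `i - m / 2` has
mean zero. -/
theorem abs_exp_parityGenerator_colHeight_sub_le_of_eq_Ioc {e : ℤ} (hxy : Even (x - y - e)) {t : ℝ}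
    (ht : 0 ≤ t) (V : State Vm Vp) :
    |(NormedSpace.exp (t • parityGenerator Vm Vp e) *ᵥ fun W => (colHeight x y W : ℝ)) V -
        ((colFloor x y V : ℝ) + colCeil x y V) / 2| ≤
      ((colCeil x y V - colFloor x y V : ℕ) + 1 : ℝ) ^ 2 *
        Real.exp (-(t / ((colCeil x y V - colFloor x y V : ℕ) + 1 : ℝ) ^ 2)) := by
  -- Outside the allowed heights `W j` is a default value that plays no role.
  have hex : ∀ j, ∃ W : State Vm Vp, colFloor x y V ≤ j → j ≤ colCeil x y V →
      IsColumnModification x y (β + j) V W := by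
    intro j
    by_cases hj : colFloor x y V ≤ j ∧ j ≤ colCeil x y V
    · obtain ⟨W, hW⟩ := exists_state_with_colHeight hβT hcol V hj.1 hj.2
      exact ⟨W, fun _ _ => hW⟩
    · exact ⟨V, fun h1 h2 => absurd ⟨h1, h2⟩ hj⟩
  choose W hW using hex
  have hlh := colFloor_le_colHeight x y V
  have hhu := colHeight_le_colCeil x y V
  have hWV : W (colHeight x y V) = V :=
    (hW _ hlh hhu).unique (isColumnModification_self hβT hcol V)
  set lo := colFloor x y V with hlo
  set up := colCeil x y V with hup
  set c : ℝ := ((lo : ℝ) + up) / 2 with hc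
  obtain ⟨m, hm⟩ : ∃ m, up = lo + m := ⟨up - lo, by omega⟩
  have hm' : up - lo = m := by omega
  set h : State Vm Vp → ℝ := fun W => (colHeight x y W : ℝ) with hh
  have hzero : ∀ i ≤ m, (NormedSpace.exp ((0 : ℝ) • parityGenerator Vm Vp e) *ᵥ h) (W (lo + i)) - c =
      i - (m : ℝ) / 2 := by
    intro i hi
    rw [zero_smul, NormedSpace.exp_zero, Matrix.one_mulVec, hh]
    dsimp only
    rw [(hW (lo + i) (by omega) (by omega)).colHeight_eq hβT hcol, hc, hm]
    push_cast
    ring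
  have key := abs_le_of_reflecting_heat_equation
    (fun i s => (NormedSpace.exp (s • parityGenerator Vm Vp e) *ᵥ h) (W (lo + i)) - c) m
    ?_ ?_ ?_ ht (j := colHeight x y V - lo) (by omega)
  · rw [Nat.add_sub_cancel' hlh, hWV] at key
    rw [hm']
    exact key
  · intro i hi s
    refine ((hasDerivAt_exp_smul_mulVec (parityGenerator Vm Vp e) h (W (lo + i)) s).sub_const
      c).congr_deriv ?_
    rw [parityGenerator_mulVec_columnModification hβT hcol hxy hW
      (exp_parityGenerator_mulVec_mem_columnFunctions hxy s
        (colHeight_mem_columnFunctions e x y)) (by omega) (by omega)]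
    simp only [← hlo, ← hup, sub_sub_sub_cancel_right]
    congr 1
    · exact if_congr (by omega) rfl rfl
    · by_cases hi0 : 0 < i
      · rw [if_pos hi0, if_pos (by omega), Nat.add_sub_assoc hi0]
      · rw [if_neg hi0, if_neg (by omega)]
  · rw [Finset.sum_congr rfl fun i hi => hzero i (Nat.lt_succ_iff.1 (Finset.mem_range.1 hi))]
    have hsum : ∀ (n : ℕ) (a : ℝ),
        ∑ i ∈ Finset.range (n + 1), ((i : ℝ) - a) = (n + 1) * (n / 2 - a) := by
      intro n a
      induction n with
      | zero => simp
      | succ n ih => rw [Finset.sum_range_succ, ih]; push_cast; ring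
    rw [hsum]
    ring
  · intro i hi
    rw [hzero i hi, abs_le]
    have : (i : ℝ) ≤ m := by exact_mod_cast hi
    constructor <;> linarith [Nat.cast_nonneg (α := ℝ) i, Nat.cast_nonneg (α := ℝ) m]

end SingleColumn

/-- The expected height of a column relaxes to the middle of the interval allowed by the other
columns. -/
theorem abs_exp_parityGenerator_colHeight_sub_le {e x y : ℤ} (hxy : Even (x - y - e)) {t : ℝ}
    (ht : 0 ≤ t) {N : ℝ} (hN : ((column Vm Vp x y).card : ℝ) + 1 ≤ N) (V : State Vm Vp) :
    |(NormedSpace.exp (t • parityGenerator Vm Vp e) *ᵥ fun W => (colHeight x y W : ℝ)) V -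
        ((colFloor x y V : ℝ) + colCeil x y V) / 2| ≤ N ^ 2 * Real.exp (-(t / N ^ 2)) := by
  rcases (column Vm Vp x y).eq_empty_or_nonempty with h | h
  · have h1 : (fun W : State Vm Vp => (colHeight x y W : ℝ)) = 0 := by
      funext W; simp [colHeight, h]
    have h2 : colFloor x y V = 0 := by simp [colFloor, h]
    have h3 : colCeil x y V = 0 := by simp [colCeil, h]
    rw [h1, h2, h3, Matrix.mulVec_zero]
    simp only [Pi.zero_apply, Nat.cast_zero, add_zero, zero_div, sub_zero, abs_zero]
    positivity
  · obtain ⟨β, T, hβT, hcol⟩ := exists_column_eq_Ioc h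
    refine (abs_exp_parityGenerator_colHeight_sub_le_of_eq_Ioc hβT hcol hxy ht V).trans ?_
    have hle : ((colCeil x y V - colFloor x y V : ℕ) + 1 : ℝ) ≤ N := by
      refine le_trans ?_ hN
      have := (Nat.sub_le (colCeil x y V) (colFloor x y V)).trans (colCeil_le_card x y V)
      exact_mod_cast Nat.succ_le_succ this
    have hpos : (0 : ℝ) < (colCeil x y V - colFloor x y V : ℕ) + 1 := by positivity
    gcongr

end ColumnDynamics

/-! ### Diagonals: the midpoint is governed by the adjacent diagonals -/

section Diagonals

open scoped Matrix

variable {Vm Vp : PositiveMonotoneSet} [Finite (region Vm Vp)]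

open Classical in
theorem card_filter_column (x y : ℤ) {K : Finset ℤ} (hK : column Vm Vp x y ⊆ K) (p : ℤ → Prop)
    [DecidablePred p] : ((column Vm Vp x y).filter p).card =
      ∑ k ∈ K, if InRegion Vm Vp x y k ∧ p k then 1 else 0 := by
  rw [Finset.card_filter, ← Finset.sum_subset hK]
  · refine Finset.sum_congr rfl fun k hk => ?_
    simp [mem_column.1 hk]
  · intro k _ hk
    rw [if_neg fun h => hk (mem_column.2 h.1)]

/-- Where all cells are in the region, `[a] + [b] = [a ∧ b] + [a ∨ b]` gives equality. At the
boundary one or both right-hand terms may be missing, and the excess is still increasing in `a` and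
`b`; cells outside the region are frozen. By `hR`, the convexity of the region, both right-hand
terms are present only if both left-hand ones are. -/
theorem ite_add_le_of_interlacing {R R' ra rb a b a' b' : Prop} [Decidable R] [Decidable R']
    [Decidable ra] [Decidable rb] [Decidable a] [Decidable b] [Decidable a'] [Decidable b']
    (ha : a → a') (hb : b → b') (hra : ¬ra → (a ↔ a')) (hrb : ¬rb → (b ↔ b'))
    (hR : R → R' → ra ∧ rb) :
    (if ra ∧ a then 1 else 0) + (if rb ∧ b then 1 else 0) + (if R ∧ (a' ∧ b') then 1 else 0) +
        (if R' ∧ (b' ∨ a') then 1 else 0) ≤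
      (if ra ∧ a' then 1 else 0) + (if rb ∧ b' then 1 else 0) + (if R ∧ (a ∧ b) then 1 else 0) +
        (if R' ∧ (b ∨ a) then 1 else 0) := by
  by_cases h1 : a <;> by_cases h2 : b <;> by_cases h3 : a' <;> by_cases h4 : b' <;>
    by_cases h5 : ra <;> by_cases h6 : rb <;> by_cases h7 : R <;> by_cases h8 : R' <;>
    simp_all

/-- The ceiling of a column and the floor of the next column on the same diagonal are governed by
the same two columns. -/
theorem colHeight_add_colCeil_add_colFloor_le (x y : ℤ) {V W : State Vm Vp} (hVW : V ≤ W) :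
    colHeight (x - 1) y V + colHeight x (y - 1) V + colCeil x y W + colFloor (x - 1) (y - 1) W ≤
      colHeight (x - 1) y W + colHeight x (y - 1) W + colCeil x y V +
        colFloor (x - 1) (y - 1) V := by
  classical
  set K := column Vm Vp (x - 1) y ∪ column Vm Vp x (y - 1) ∪ column Vm Vp x y ∪
    column Vm Vp (x - 1) (y - 1) with hK
  have h1 : column Vm Vp (x - 1) y ⊆ K := fun k hk => by simp [hK, hk]
  have h2 : column Vm Vp x (y - 1) ⊆ K := fun k hk => by simp [hK, hk]
  have h3 : column Vm Vp x y ⊆ K := fun k hk => by simp [hK, hk]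
  have h4 : column Vm Vp (x - 1) (y - 1) ⊆ K := fun k hk => by simp [hK, hk]
  simp only [colHeight, colCeil, colFloor, sub_add_cancel]
  simp only [card_filter_column _ _ h1, card_filter_column _ _ h2, card_filter_column _ _ h3,
    card_filter_column _ _ h4, ← Finset.sum_add_distrib]
  refine Finset.sum_le_sum fun k _ => ?_
  refine ite_add_le_of_interlacing (fun h => h.mono hVW) (fun h => h.mono hVW)
    (fun h => hasCube_iff_of_not_inRegion h V W) (fun h => hasCube_iff_of_not_inRegion h V W) ?_
  intro hR hR'
  exact ⟨hR'.of_between hR le_rfl (by omega) (by omega) le_rfl le_rfl le_rfl,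
    hR'.of_between hR (by omega) le_rfl le_rfl (by omega) le_rfl le_rfl⟩

variable (Vm Vp) in
/-- The first coordinates of the sites of the region. -/
noncomputable def firstCoords : Finset ℤ :=
  Finset.univ.image fun z : region Vm Vp => coord z 0

theorem column_eq_empty_of_notMem {x : ℤ} (hx : x ∉ firstCoords Vm Vp) (y : ℤ) :
    column Vm Vp x y = ∅ := by
  rw [Finset.eq_empty_iff_forall_notMem]
  intro k hk
  obtain ⟨z, h0, -, -⟩ := inRegion_iff.1 (mem_column.1 hk)
  exact hx (Finset.mem_image.2 ⟨z, Finset.mem_univ z, h0⟩)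

/-- The number of sites of `V` on the diagonal `d`. -/
noncomputable def diagHeight (d : ℤ) (V : State Vm Vp) : ℝ :=
  ∑ x ∈ firstCoords Vm Vp, (colHeight x (x - d) V : ℝ)

/-- The equilibrium value of `diagHeight`, given the neighbouring diagonals. -/
noncomputable def diagMid (d : ℤ) (V : State Vm Vp) : ℝ :=
  ∑ x ∈ firstCoords Vm Vp, ((colFloor x (x - d) V : ℝ) + colCeil x (x - d) V) / 2

theorem colHeight_mono (x y : ℤ) : Monotone (colHeight (Vm := Vm) (Vp := Vp) x y) := by
  classical
  intro V W hVW
  exact Finset.card_le_card (Finset.monotone_filter_right _ fun k _ h => h.mono hVW)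

theorem diagHeight_mono (d : ℤ) : Monotone (diagHeight (Vm := Vm) (Vp := Vp) d) :=
  fun _ _ hVW => Finset.sum_le_sum fun _ _ => Nat.cast_le.2 (colHeight_mono _ _ hVW)

/-- The excess of the average of two neighbouring diagonals over the equilibrium value of the
diagonal between them is monotone. -/
theorem monotone_average_sub_diagMid (d : ℤ) : Monotone fun V : State Vm Vp =>
    (diagHeight (d - 1) V + diagHeight (d + 1) V) / 2 - diagMid d V := by
  classical
  set X := firstCoords Vm Vp with hX
  -- Floors and one of the adjacent diagonals are shifted by one step, so that the terms attached to
  -- the same two columns share an index; `I` serves both ranges.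
  set I := X ∪ X.image (· + 1) with hI
  have hshift : ∀ F : ℤ → ℝ, (∀ x, x ∉ X → F x = 0) → ∑ x ∈ X, F x = ∑ x ∈ I, F (x - 1) := by
    intro F hF
    have h1 : ∑ x ∈ X, F x = ∑ x ∈ X.image (· + 1), F (x - 1) := by
      rw [Finset.sum_image (add_left_injective 1).injOn]
      exact Finset.sum_congr rfl fun x _ => by rw [add_sub_cancel_right]
    rw [h1]
    refine Finset.sum_subset Finset.subset_union_right fun x _ hx => hF _ fun h => hx ?_
    exact Finset.mem_image.2 ⟨x - 1, h, sub_add_cancel x 1⟩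
  have hext : ∀ F : ℤ → ℝ, (∀ x, x ∉ X → F x = 0) → ∑ x ∈ X, F x = ∑ x ∈ I, F x :=
    fun F hF => Finset.sum_subset Finset.subset_union_left fun x _ hx => hF _ hx
  have hh : ∀ V : State Vm Vp, ∀ x y, x ∉ X → (colHeight x y V : ℝ) = 0 := fun V x y hx => by
    simp [colHeight, column_eq_empty_of_notMem hx]
  have hf : ∀ V : State Vm Vp, ∀ x y, x ∉ X → (colFloor x y V : ℝ) = 0 := fun V x y hx => by
    simp [colFloor, column_eq_empty_of_notMem hx]
  have hc : ∀ V : State Vm Vp, ∀ x y, x ∉ X → (colCeil x y V : ℝ) = 0 := fun V x y hx => by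
    simp [colCeil, column_eq_empty_of_notMem hx]
  have key : ∀ V : State Vm Vp, (diagHeight (d - 1) V + diagHeight (d + 1) V) / 2 - diagMid d V =
      1 / 2 * ∑ x ∈ I, ((colHeight (x - 1) (x - d) V : ℝ) + colHeight x (x - d - 1) V -
        colCeil x (x - d) V - colFloor (x - 1) (x - d - 1) V) := by
    intro V
    have e1 : diagHeight (d - 1) V = ∑ x ∈ I, (colHeight (x - 1) (x - d) V : ℝ) := by
      rw [diagHeight, hshift _ fun x hx => hh V x _ hx]
      exact Finset.sum_congr rfl fun x _ => by congr 2; ring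
    have e2 : diagHeight (d + 1) V = ∑ x ∈ I, (colHeight x (x - d - 1) V : ℝ) := by
      rw [diagHeight, hext _ fun x hx => hh V x _ hx]
      exact Finset.sum_congr rfl fun x _ => by congr 2; ring
    have e3 : ∑ x ∈ X, (colFloor x (x - d) V : ℝ) =
        ∑ x ∈ I, (colFloor (x - 1) (x - d - 1) V : ℝ) := by
      rw [hshift _ fun x hx => hf V x _ hx]
      exact Finset.sum_congr rfl fun x _ => by congr 2; ring
    have e4 : ∑ x ∈ X, (colCeil x (x - d) V : ℝ) = ∑ x ∈ I, (colCeil x (x - d) V : ℝ) :=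
      hext _ fun x hx => hc V x _ hx
    rw [diagMid, ← Finset.sum_div, Finset.sum_add_distrib, e1, e2, e3, e4]
    simp only [Finset.sum_sub_distrib, Finset.sum_add_distrib]
    ring
  intro V W hVW
  dsimp only
  rw [key, key]
  refine mul_le_mul_of_nonneg_left (Finset.sum_le_sum fun x _ => ?_) (by norm_num)
  have h : ((colHeight (x - 1) (x - d) V + colHeight x (x - d - 1) V + colCeil x (x - d) W +
      colFloor (x - 1) (x - d - 1) W : ℕ) : ℝ) ≤ (colHeight (x - 1) (x - d) W +
      colHeight x (x - d - 1) W + colCeil x (x - d) V + colFloor (x - 1) (x - d - 1) V : ℕ) :=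
    Nat.cast_le.2 (colHeight_add_colCeil_add_colFloor_le x (x - d) hVW)
  push_cast at h
  linarith

theorem abs_exp_parityGenerator_diagHeight_sub_le {e d : ℤ} (hd : Even (d - e)) {t : ℝ} (ht : 0 ≤ t)
    {N : ℝ} (hN : ∀ x y, ((column Vm Vp x y).card : ℝ) + 1 ≤ N) (V : State Vm Vp) :
    |(NormedSpace.exp (t • parityGenerator Vm Vp e) *ᵥ diagHeight d) V - diagMid d V| ≤
      (firstCoords Vm Vp).card * (N ^ 2 * Real.exp (-(t / N ^ 2))) := by
  have e1 : diagHeight (Vm := Vm) (Vp := Vp) d =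
      ∑ x ∈ firstCoords Vm Vp, fun V => (colHeight x (x - d) V : ℝ) := by
    funext V
    rw [diagHeight, Finset.sum_apply]
  rw [e1, Matrix.mulVec_sum, Finset.sum_apply, diagMid, ← Finset.sum_sub_distrib, ← nsmul_eq_mul,
    ← Finset.sum_const]
  refine (Finset.abs_sum_le_sum_abs _ _).trans (Finset.sum_le_sum fun x _ => ?_)
  exact abs_exp_parityGenerator_colHeight_sub_le (by rwa [sub_sub_cancel]) ht (hN _ _) V

theorem exp_parityGenerator_mulVec_diagHeight {e d : ℤ} (hd : ¬Even (d - e)) (t : ℝ) :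
    NormedSpace.exp (t • parityGenerator Vm Vp e) *ᵥ diagHeight d = diagHeight d := by
  classical
  refine exp_flipGenerator_mulVec_of_invariant isMonotoneFlip_siteUpdate _ t fun z hz V => ?_
  rw [diagHeight, diagHeight]
  refine Finset.sum_congr rfl fun x _ => ?_
  rw [colHeight, colHeight]
  congr 2
  refine Finset.filter_congr fun k _ => hasCube_congr fun p h0 h1 => mem_flipState_of_ne z V ?_
  rintro rfl
  rw [mem_paritySites, h0, h1, sub_sub_cancel] at hz
  exact hd hz

/-- Operators that preserve order, constants and monotone functions. -/
structure IsMonotoneMarkov {Ω : Type*} [Fintype Ω] [PartialOrder Ω] (Q : Matrix Ω Ω ℝ) : Prop where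
  mono : ∀ f g : Ω → ℝ, f ≤ g → Q *ᵥ f ≤ Q *ᵥ g
  const : ∀ a : ℝ, Q *ᵥ (fun _ => a) = fun _ => a
  monotone_mulVec : ∀ f : Ω → ℝ, Monotone f → Monotone (Q *ᵥ f)

theorem IsMonotoneMarkov.one {Ω : Type*} [Fintype Ω] [DecidableEq Ω] [PartialOrder Ω] :
    IsMonotoneMarkov (1 : Matrix Ω Ω ℝ) :=
  ⟨fun f g h => by simpa using h, fun a => by simp, fun f hf => by simpa using hf⟩

theorem IsMonotoneMarkov.mul {Ω : Type*} [Fintype Ω] [PartialOrder Ω] {Q Q' : Matrix Ω Ω ℝ}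
    (h : IsMonotoneMarkov Q) (h' : IsMonotoneMarkov Q') : IsMonotoneMarkov (Q * Q') :=
  ⟨fun f g hfg => by
    rw [← Matrix.mulVec_mulVec, ← Matrix.mulVec_mulVec]; exact h.mono _ _ (h'.mono _ _ hfg),
  fun a => by rw [← Matrix.mulVec_mulVec, h'.const, h.const],
  fun f hf => by
    rw [← Matrix.mulVec_mulVec]; exact h.monotone_mulVec _ (h'.monotone_mulVec _ hf)⟩

theorem isMonotoneMarkov_exp_parityGenerator (e : ℤ) {t : ℝ} (ht : 0 ≤ t) :
    IsMonotoneMarkov (NormedSpace.exp (t • parityGenerator Vm Vp e)) :=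
  ⟨fun _ _ h => exp_flipGenerator_mulVec_mono isMonotoneFlip_siteUpdate _ ht h,
    exp_flipGenerator_mulVec_const isMonotoneFlip_siteUpdate _ t,
    (isSymmMonotone_exp_flipGenerator isMonotoneFlip_siteUpdate _ ht).monotone_mulVec⟩

/-- The difference of the expectations of `diagHeight d` from two starting points. -/
noncomputable def diagGap (Q : Matrix (State Vm Vp) (State Vm Vp) ℝ) (V W : State Vm Vp)
    (d : ℤ) : ℝ :=
  (Q *ᵥ diagHeight d) W - (Q *ᵥ diagHeight d) V

theorem diagGap_mul_exp_of_not_even {e d : ℤ} (hd : ¬Even (d - e)) (t : ℝ)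
    (Q : Matrix (State Vm Vp) (State Vm Vp) ℝ) (V W : State Vm Vp) :
    diagGap (Q * NormedSpace.exp (t • parityGenerator Vm Vp e)) V W d = diagGap Q V W d := by
  rw [diagGap, ← Matrix.mulVec_mulVec, exp_parityGenerator_mulVec_diagHeight hd, diagGap]

/-- Relaxation replaces `diagHeight d` by `diagMid d`, which is the average of the adjacent
diagonals minus a monotone `B`. As `Q` preserves monotonicity, `B` only lowers the gap. The
relaxation error is paid at both starting points. -/
theorem diagGap_mul_exp_le {e d : ℤ} (hd : Even (d - e)) {t : ℝ} (ht : 0 ≤ t)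
    {N : ℝ} (hN : ∀ x y, ((column Vm Vp x y).card : ℝ) + 1 ≤ N)
    {Q : Matrix (State Vm Vp) (State Vm Vp) ℝ} (hQ : IsMonotoneMarkov Q) {V W : State Vm Vp}
    (hVW : V ≤ W) :
    diagGap (Q * NormedSpace.exp (t • parityGenerator Vm Vp e)) V W d ≤
      (diagGap Q V W (d - 1) + diagGap Q V W (d + 1)) / 2 +
        2 * ((firstCoords Vm Vp).card * (N ^ 2 * Real.exp (-(t / N ^ 2)))) := by
  set η : ℝ := (firstCoords Vm Vp).card * (N ^ 2 * Real.exp (-(t / N ^ 2))) with hη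
  set u := NormedSpace.exp (t • parityGenerator Vm Vp e) *ᵥ diagHeight d with hu
  set B : State Vm Vp → ℝ := fun V =>
    (diagHeight (d - 1) V + diagHeight (d + 1) V) / 2 - diagMid d V with hB
  have hmid : ∀ V, |u V - diagMid d V| ≤ η := fun V =>
    abs_exp_parityGenerator_diagHeight_sub_le hd ht hN V
  have hQmid : Q *ᵥ diagMid d =
      (1 / 2 : ℝ) • (Q *ᵥ diagHeight (d - 1) + Q *ᵥ diagHeight (d + 1)) - Q *ᵥ B := by
    rw [← Matrix.mulVec_add, ← Matrix.mulVec_smul, ← Matrix.mulVec_sub]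
    congr 1
    funext V
    simp only [hB, Pi.sub_apply, Pi.smul_apply, Pi.add_apply, smul_eq_mul]
    ring
  have h1 : ∀ V, (Q *ᵥ u) V ≤ (Q *ᵥ diagMid d) V + η := by
    intro V
    have h := hQ.mono u (diagMid d + fun _ => η)
      (fun V => by
        have := (abs_le.1 (hmid V)).2
        simp only [Pi.add_apply]
        linarith) V
    rwa [Matrix.mulVec_add, hQ.const] at h
  have h2 : ∀ V, (Q *ᵥ diagMid d) V ≤ (Q *ᵥ u) V + η := by
    intro V
    have h := hQ.mono (diagMid d) (u + fun _ => η)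
      (fun V => by
        have := (abs_le.1 (hmid V)).1
        simp only [Pi.add_apply]
        linarith) V
    rwa [Matrix.mulVec_add, hQ.const] at h
  have h3 := hQ.monotone_mulVec B (monotone_average_sub_diagMid d) hVW
  have h4 := h1 W
  have h5 := h2 V
  rw [hQmid] at h4 h5
  simp only [Pi.sub_apply, Pi.smul_apply, Pi.add_apply, smul_eq_mul] at h4 h5
  rw [diagGap, ← Matrix.mulVec_mulVec, diagGap, diagGap]
  linarith

end Diagonals

/-! ### Contraction in a concave weight -/

section WeightedContraction

/-- The weight `g d = 2 R² - (d - c)²` loses exactly 1 when averaged over the two neighbours and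
lies between `R²` and `2 R²` on the window. Each diagonal is averaged once in the two steps, so `K *
g` becomes at most `K * (g - 1) + 2 * η`; the bounds on `g` make this a multiplicative contraction.
Near the edge, where a neighbour may leave the window, the values are nonpositive. -/
theorem weighted_bound_of_two_steps {v₀ v₁ v₂ : ℤ → ℝ} {c R K η : ℝ} (hR : 1 ≤ R) (hK : 0 ≤ K)
    (hη : 0 ≤ η) (h1e : ∀ d, Even d → v₁ d ≤ (v₀ (d - 1) + v₀ (d + 1)) / 2 + η)
    (h1o : ∀ d, ¬Even d → v₁ d ≤ v₀ d)
    (h2o : ∀ d, ¬Even d → v₂ d ≤ (v₁ (d - 1) + v₁ (d + 1)) / 2 + η)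
    (h2e : ∀ d, Even d → v₂ d ≤ v₁ d) (hs1 : ∀ d : ℤ, R - 1 < |(d : ℝ) - c| → v₁ d ≤ 0)
    (hs2 : ∀ d : ℤ, R - 1 < |(d : ℝ) - c| → v₂ d ≤ 0)
    (h0 : ∀ d : ℤ, |(d : ℝ) - c| ≤ R → v₀ d ≤ K * (2 * R ^ 2 - ((d : ℝ) - c) ^ 2)) (d : ℤ)
    (hd : |(d : ℝ) - c| ≤ R) :
    v₂ d ≤ ((1 - 1 / (2 * R ^ 2)) * K + 2 * η / R ^ 2) * (2 * R ^ 2 - ((d : ℝ) - c) ^ 2) := by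
  have hg : ∀ d : ℤ, |(d : ℝ) - c| ≤ R → R ^ 2 ≤ 2 * R ^ 2 - ((d : ℝ) - c) ^ 2 := by
    intro d hd
    have := sq_le_sq' (abs_le.1 hd).1 (abs_le.1 hd).2
    linarith
  have hR2 : 1 ≤ R ^ 2 := one_le_pow₀ hR
  have hnb : ∀ d : ℤ, |(d : ℝ) - c| ≤ R - 1 →
      |((d - 1 : ℤ) : ℝ) - c| ≤ R ∧ |((d + 1 : ℤ) : ℝ) - c| ≤ R := by
    intro d hd
    rw [abs_le] at hd
    push_cast
    constructor <;> rw [abs_le] <;> constructor <;> linarith [hd.1, hd.2]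
  have h1e' : ∀ d : ℤ, Even d → |(d : ℝ) - c| ≤ R →
      v₁ d ≤ K * (2 * R ^ 2 - ((d : ℝ) - c) ^ 2 - 1) + η := by
    intro d hde hd
    rcases le_or_gt |(d : ℝ) - c| (R - 1) with h | h
    · have e1 := h0 _ (hnb d h).1
      have e2 := h0 _ (hnb d h).2
      have e3 := h1e d hde
      push_cast at e1 e2
      linarith
    · have e1 := hs1 d h
      have e2 : 0 ≤ K * (2 * R ^ 2 - ((d : ℝ) - c) ^ 2 - 1) :=
        mul_nonneg hK (by linarith [hg d hd])
      linarith
  have h1o' : ∀ d : ℤ, ¬Even d → |(d : ℝ) - c| ≤ R →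
      v₁ d ≤ K * (2 * R ^ 2 - ((d : ℝ) - c) ^ 2) := fun d hdo hd => (h1o d hdo).trans (h0 d hd)
  have h2 : v₂ d ≤ K * (2 * R ^ 2 - ((d : ℝ) - c) ^ 2 - 1) + 2 * η := by
    by_cases hde : Even d
    · linarith [h2e d hde, h1e' d hde hd]
    · rcases le_or_gt |(d : ℝ) - c| (R - 1) with h | h
      · have hdm : Even (d - 1) := by rw [Int.even_iff] at *; omega
        have hdp : Even (d + 1) := by rw [Int.even_iff] at *; omega
        have e1 := h1e' _ hdm (hnb d h).1
        have e2 := h1e' _ hdp (hnb d h).2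
        have e3 := h2o d hde
        push_cast at e1 e2
        linarith
      · have e1 := hs2 d h
        have e2 : 0 ≤ K * (2 * R ^ 2 - ((d : ℝ) - c) ^ 2 - 1) :=
          mul_nonneg hK (by linarith [hg d hd])
        linarith
  set g := 2 * R ^ 2 - ((d : ℝ) - c) ^ 2 with hgd
  have hgl : R ^ 2 ≤ g := hg d hd
  have hgu : g ≤ 2 * R ^ 2 := by rw [hgd]; linarith [sq_nonneg ((d : ℝ) - c)]
  have e1 : K * (g / (2 * R ^ 2)) ≤ K * 1 :=
    mul_le_mul_of_nonneg_left ((div_le_one (by positivity)).2 hgu) hK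
  have e2 : 2 * η * 1 ≤ 2 * η * (g / R ^ 2) :=
    mul_le_mul_of_nonneg_left ((one_le_div (by positivity)).2 hgl) (by positivity)
  have e3 : ((1 - 1 / (2 * R ^ 2)) * K + 2 * η / R ^ 2) * g =
      K * g - K * (g / (2 * R ^ 2)) + 2 * η * (g / R ^ 2) := by ring
  rw [e3]
  linarith

theorem card_le_of_sub_le (s : Finset ℤ) {r : ℝ} (hr : 0 ≤ r)
    (h : ∀ a ∈ s, ∀ b ∈ s, (a : ℝ) - b ≤ r) : (s.card : ℝ) ≤ r + 1 := by
  rcases s.eq_empty_or_nonempty with rfl | hs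
  · simp; linarith
  have hsub : s ⊆ Finset.Icc (s.min' hs) (s.max' hs) := fun k hk =>
    Finset.mem_Icc.2 ⟨Finset.min'_le _ k hk, Finset.le_max' _ k hk⟩
  have h1 := Finset.card_le_card hsub
  rw [Int.card_Icc] at h1
  have h2 := h _ (Finset.max'_mem s hs) _ (Finset.min'_mem s hs)
  have h3 := Finset.min'_le_max' s hs
  have h4 : (s.card : ℤ) ≤ s.max' hs + 1 - s.min' hs := by omega
  have h5 : (s.card : ℝ) ≤ s.max' hs + 1 - s.min' hs := by exact_mod_cast h4
  linarith

theorem sum_add_one_le_sum {ι : Type*} {s : Finset ι} {f g : ι → ℝ} (h : ∀ i ∈ s, f i ≤ g i) {i : ι}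
    (hi : i ∈ s) (hfg : f i + 1 ≤ g i) : ∑ i ∈ s, f i + 1 ≤ ∑ i ∈ s, g i := by
  have := Finset.single_le_sum (f := fun i => g i - f i) (fun i hi => sub_nonneg.2 (h i hi)) hi
  rw [Finset.sum_sub_distrib] at this
  linarith

end WeightedContraction

/-! ### Size of the region in terms of `D` and `H` -/

section RegionSize

variable {Vm Vp : PositiveMonotoneSet} [Finite (region Vm Vp)]

theorem horizontalDist_le_horizontalDiameter (z y : region Vm Vp) :
    horizontalDist z y ≤ horizontalDiameter (region Vm Vp) := by
  refine le_csSup ?_ ⟨z, z.2, y, y.2, rfl⟩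
  refine (Set.Finite.subset (Set.finite_range
    fun q : region Vm Vp × region Vm Vp => horizontalDist q.1 q.2) ?_).bddAbove
  rintro r ⟨z, hz, y, hy, rfl⟩
  exact ⟨(⟨z, hz⟩, ⟨y, hy⟩), rfl⟩

theorem coord_sub_le_horizontalDiameter (z y : region Vm Vp) :
    |(coord z 0 : ℝ) - coord y 0| ≤ horizontalDiameter (region Vm Vp) ∧
      |(coord z 1 : ℝ) - coord y 1| ≤ horizontalDiameter (region Vm Vp) := by
  have h := horizontalDist_le_horizontalDiameter z y
  simp only [coord, Int.cast_natCast]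
  constructor
  · refine le_trans (Real.abs_le_sqrt ?_) h
    linarith [sq_nonneg ((((z : Point) 1 : ℕ) : ℝ) - ((y : Point) 1 : ℕ))]
  · refine le_trans (Real.abs_le_sqrt ?_) h
    linarith [sq_nonneg ((((z : Point) 0 : ℕ) : ℝ) - ((y : Point) 0 : ℕ))]

theorem coord_sub_le_verticalThickness (z y : region Vm Vp) (h0 : coord y 0 = coord z 0)
    (h1 : coord y 1 = coord z 1) :
    |(coord z 2 : ℝ) - coord y 2| ≤ verticalThickness (region Vm Vp) := by
  simp only [coord, Nat.cast_inj, PNat.coe_inj] at h0 h1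
  refine le_csSup ?_ ⟨z, z.2, y, y.2, h0, h1, by simp [coord]⟩
  refine (Set.Finite.subset (Set.finite_range fun q : region Vm Vp × region Vm Vp =>
    |((q.1 : Point) 2 : ℝ) - ((q.2 : Point) 2 : ℝ)|) ?_).bddAbove
  rintro r ⟨z, hz, y, hy, -, -, rfl⟩
  exact ⟨(⟨z, hz⟩, ⟨y, hy⟩), rfl⟩

theorem horizontalDiameter_nonneg (Λ : Set Point) : 0 ≤ horizontalDiameter Λ := by
  refine Real.sSup_nonneg ?_
  rintro r ⟨z, _, y, _, rfl⟩
  exact Real.sqrt_nonneg _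

theorem verticalThickness_nonneg (Λ : Set Point) : 0 ≤ verticalThickness Λ := by
  refine Real.sSup_nonneg ?_
  rintro r ⟨z, _, y, _, _, _, rfl⟩
  exact abs_nonneg _

theorem card_firstCoords_le :
    ((firstCoords Vm Vp).card : ℝ) ≤ horizontalDiameter (region Vm Vp) + 1 := by
  refine card_le_of_sub_le _ (horizontalDiameter_nonneg _) fun a ha b hb => ?_
  obtain ⟨z, -, rfl⟩ := Finset.mem_image.1 ha
  obtain ⟨y, -, rfl⟩ := Finset.mem_image.1 hb
  exact (le_abs_self _).trans (coord_sub_le_horizontalDiameter z y).1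

theorem card_column_le (x y : ℤ) :
    ((column Vm Vp x y).card : ℝ) ≤ verticalThickness (region Vm Vp) + 1 := by
  refine card_le_of_sub_le _ (verticalThickness_nonneg _) fun a ha b hb => ?_
  obtain ⟨z, hz0, hz1, rfl⟩ := inRegion_iff.1 (mem_column.1 ha)
  obtain ⟨w, hw0, hw1, rfl⟩ := inRegion_iff.1 (mem_column.1 hb)
  exact (le_abs_self _).trans
    (coord_sub_le_verticalThickness z w (hw0.trans hz0.symm) (hw1.trans hz1.symm))

variable (Vm Vp) in
/-- The diagonals that meet the region. -/
noncomputable def diagonals : Finset ℤ :=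
  Finset.univ.image fun z : region Vm Vp => coord z 0 - coord z 1

theorem abs_sub_le_of_mem_diagonals {a b : ℤ} (ha : a ∈ diagonals Vm Vp)
    (hb : b ∈ diagonals Vm Vp) : |(a : ℝ) - b| ≤ 2 * horizontalDiameter (region Vm Vp) := by
  obtain ⟨z, -, rfl⟩ := Finset.mem_image.1 ha
  obtain ⟨y, -, rfl⟩ := Finset.mem_image.1 hb
  obtain ⟨h0, h1⟩ := coord_sub_le_horizontalDiameter z y
  rw [abs_le] at *
  push_cast
  constructor <;> linarith [h0.1, h0.2, h1.1, h1.2]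

theorem card_diagonals_le :
    ((diagonals Vm Vp).card : ℝ) ≤ 2 * horizontalDiameter (region Vm Vp) + 1 :=
  card_le_of_sub_le _ (by linarith [horizontalDiameter_nonneg (region Vm Vp)]) fun _ ha _ hb =>
    (le_abs_self _).trans (abs_sub_le_of_mem_diagonals ha hb)

theorem diagHeight_eq_zero {d : ℤ} (hd : d ∉ diagonals Vm Vp) :
    diagHeight (Vm := Vm) (Vp := Vp) d = 0 := by
  funext V
  refine Finset.sum_eq_zero fun x _ => ?_
  have : column Vm Vp x (x - d) = ∅ := by
    rw [Finset.eq_empty_iff_forall_notMem]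
    intro k hk
    obtain ⟨z, h0, h1, -⟩ := inRegion_iff.1 (mem_column.1 hk)
    exact hd (Finset.mem_image.2 ⟨z, Finset.mem_univ z, by omega⟩)
  simp [colHeight, this]

/-- The number of sites of the region that belong to `V`. -/
noncomputable def volumeIn (V : State Vm Vp) : ℝ :=
  ∑ d ∈ diagonals Vm Vp, diagHeight d V

theorem volumeIn_add_one_le {V W : State Vm Vp} (hVW : V < W) : volumeIn V + 1 ≤ volumeIn W := by
  classical
  obtain ⟨p, hpW, hpV⟩ : ∃ p, p ∈ W.1 ∧ p ∉ V.1 := by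
    by_contra! h
    exact hVW.not_ge fun p hp => h p hp
  set z : region Vm Vp := ⟨p, W.2.2 hpW, fun hp => hpV (V.2.1 hp)⟩ with hz
  have hd : coord p 0 - coord p 1 ∈ diagonals Vm Vp :=
    Finset.mem_image.2 ⟨z, Finset.mem_univ z, rfl⟩
  have hx : coord p 0 ∈ firstCoords Vm Vp := Finset.mem_image.2 ⟨z, Finset.mem_univ z, rfl⟩
  refine sum_add_one_le_sum (fun d _ => diagHeight_mono d hVW.le) hd ?_
  refine sum_add_one_le_sum (fun x _ => Nat.cast_le.2 (colHeight_mono _ _ hVW.le)) hx ?_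
  rw [sub_sub_cancel]
  have hk : coord p 2 ∈ column Vm Vp (coord p 0) (coord p 1) :=
    mem_column.2 (inRegion_iff.2 ⟨z, rfl, rfl, rfl⟩)
  have hlt : colHeight (coord p 0) (coord p 1) V < colHeight (coord p 0) (coord p 1) W := by
    refine Finset.card_lt_card (Finset.ssubset_iff_of_subset
      (Finset.monotone_filter_right _ fun k _ h => h.mono hVW.le) |>.2 ⟨coord p 2, ?_, ?_⟩)
    · exact Finset.mem_filter.2 ⟨hk, hasCube_coord.2 hpW⟩
    · exact fun h => hpV (hasCube_coord.1 (Finset.mem_filter.1 h).2)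
  exact_mod_cast hlt

end RegionSize

/-! ### The alternating dynamics and its comparison with the true one -/

section AlternatingDynamics

open scoped Matrix

variable {Vm Vp : PositiveMonotoneSet} [Finite (region Vm Vp)]

theorem diagGap_eq_zero {d : ℤ} (hd : d ∉ diagonals Vm Vp)
    (Q : Matrix (State Vm Vp) (State Vm Vp) ℝ) (V W : State Vm Vp) : diagGap Q V W d = 0 := by
  simp [diagGap, diagHeight_eq_zero hd]

variable (Vm Vp) in
/-- One round of the alternating dynamics: the even diagonals evolve for a time `t`, then the odd
ones. -/
noncomputable def alternatingRound (t : ℝ) : Matrix (State Vm Vp) (State Vm Vp) ℝ :=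
  NormedSpace.exp (t • parityGenerator Vm Vp 0) * NormedSpace.exp (t • parityGenerator Vm Vp 1)

theorem isMonotoneMarkov_alternatingRound_pow {t : ℝ} (ht : 0 ≤ t) (n : ℕ) :
    IsMonotoneMarkov (alternatingRound Vm Vp t ^ n) := by
  induction n with
  | zero => simpa using IsMonotoneMarkov.one
  | succ n ih =>
    rw [pow_succ]
    exact ih.mul ((isMonotoneMarkov_exp_parityGenerator 0 ht).mul
      (isMonotoneMarkov_exp_parityGenerator 1 ht))

/-- Iteration of the two-step contraction: `4 * η` is the fixed point of `K ↦ (1 - 1 / (2 R²)) K + 2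
η / R²`. Initially a diagonal has volume at most `A * N`, and the weight is at least `R²`. -/
theorem diagGap_alternatingRound_pow_le {t : ℝ} (ht : 0 ≤ t) {N R A : ℝ} (hR : 1 ≤ R)
    (hN : ∀ x y, ((column Vm Vp x y).card : ℝ) + 1 ≤ N)
    (hA : ((firstCoords Vm Vp).card : ℝ) ≤ A) {c : ℝ}
    (hc : ∀ d ∈ diagonals Vm Vp, |(d : ℝ) - c| ≤ R - 1) {V W : State Vm Vp} (hVW : V ≤ W) (n : ℕ)
    (d : ℤ) (hd : |(d : ℝ) - c| ≤ R) :
    diagGap (alternatingRound Vm Vp t ^ n) V W d ≤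
      ((1 - 1 / (2 * R ^ 2)) ^ n * (A * N / R ^ 2) +
        4 * (2 * (A * (N ^ 2 * Real.exp (-(t / N ^ 2)))))) *
        (2 * R ^ 2 - ((d : ℝ) - c) ^ 2) := by
  set ε := N ^ 2 * Real.exp (-(t / N ^ 2)) with hε
  set η := 2 * (A * ε) with hη
  have hε0 : 0 ≤ ε := by positivity
  have hA0 : 0 ≤ A := (Nat.cast_nonneg _).trans hA
  have hN0 : 0 ≤ N := by
    have := hN 0 0
    linarith [Nat.cast_nonneg (α := ℝ) (column Vm Vp 0 0).card]
  have hη0 : 0 ≤ η := by positivity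
  have hR2 : 1 ≤ R ^ 2 := one_le_pow₀ hR
  have hq : 0 ≤ 1 - 1 / (2 * R ^ 2) := by
    rw [sub_nonneg, div_le_one (by positivity)]
    linarith
  have hs : ∀ Q (d : ℤ), R - 1 < |(d : ℝ) - c| → diagGap Q V W d ≤ 0 := fun Q d hd =>
    (diagGap_eq_zero (fun h => absurd (hc d h) (not_le.2 hd)) Q V W).le
  have hstep : ∀ {Q : Matrix (State Vm Vp) (State Vm Vp) ℝ}, IsMonotoneMarkov Q → ∀ {e d : ℤ},
      Even (d - e) → diagGap (Q * NormedSpace.exp (t • parityGenerator Vm Vp e)) V W d ≤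
        (diagGap Q V W (d - 1) + diagGap Q V W (d + 1)) / 2 + η := by
    intro Q hQ e d hd
    refine (diagGap_mul_exp_le hd ht hN hQ hVW).trans ?_
    rw [hη]
    gcongr
  induction n generalizing d with
  | zero =>
    have h1 : diagGap (alternatingRound Vm Vp t ^ 0) V W d ≤ A * N := by
      rw [pow_zero, diagGap, Matrix.one_mulVec]
      have h2 : 0 ≤ diagHeight d V := Finset.sum_nonneg fun _ _ => Nat.cast_nonneg _
      have h3 : diagHeight d W ≤ A * N := by
        calc diagHeight d W ≤ ∑ _x ∈ firstCoords Vm Vp, N := by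
              refine Finset.sum_le_sum fun x _ => ?_
              have h4 : (colHeight x (x - d) W : ℝ) ≤ (column Vm Vp x (x - d)).card :=
                Nat.cast_le.2 ((colHeight_le_colCeil _ _ W).trans (colCeil_le_card _ _ W))
              linarith [hN x (x - d)]
          _ = (firstCoords Vm Vp).card * N := by rw [Finset.sum_const, nsmul_eq_mul]
          _ ≤ A * N := by gcongr
      linarith
    have h5 : R ^ 2 ≤ 2 * R ^ 2 - ((d : ℝ) - c) ^ 2 := by
      have := sq_le_sq' (abs_le.1 hd).1 (abs_le.1 hd).2
      linarith
    have h6 : A * N = A * N / R ^ 2 * R ^ 2 := by field_simp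
    rw [pow_zero (1 - 1 / (2 * R ^ 2)), one_mul]
    calc _ ≤ A * N := h1
      _ = A * N / R ^ 2 * R ^ 2 := h6
      _ ≤ _ := by gcongr; linarith
  | succ n ih =>
    have hQ := isMonotoneMarkov_alternatingRound_pow (Vm := Vm) (Vp := Vp) ht n
    have hQ' := hQ.mul (isMonotoneMarkov_exp_parityGenerator 0 ht)
    rw [pow_succ, alternatingRound, ← mul_assoc, ← alternatingRound]
    have key := weighted_bound_of_two_steps (v₀ := diagGap (alternatingRound Vm Vp t ^ n) V W)
      (v₁ := diagGap (alternatingRound Vm Vp t ^ n *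
        NormedSpace.exp (t • parityGenerator Vm Vp 0)) V W)
      (v₂ := diagGap (alternatingRound Vm Vp t ^ n *
        NormedSpace.exp (t • parityGenerator Vm Vp 0) *
        NormedSpace.exp (t • parityGenerator Vm Vp 1)) V W)
      (c := c) (K := (1 - 1 / (2 * R ^ 2)) ^ n * (A * N / R ^ 2) + 4 * η) hR (by positivity) hη0
      (fun d hd => hstep hQ (by simpa using hd))
      (fun d hd => (diagGap_mul_exp_of_not_even (by simpa using hd) t _ V W).le)
      (fun d hd => hstep hQ' (by rw [Int.even_iff] at *; omega))
      (fun d hd => (diagGap_mul_exp_of_not_even (by rw [Int.even_iff] at *; omega) t _ V W).le)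
      (hs _) (hs _) ih d hd
    refine key.trans (le_of_eq ?_)
    have hr : 1 / (2 * R ^ 2) * (4 * η) = 2 * η / R ^ 2 := by field_simp; ring
    congr 1
    rw [pow_succ']
    linear_combination -hr

theorem volumeIn_alternatingRound_pow_le {t : ℝ} (ht : 0 ≤ t) {N R A M : ℝ} (hR : 1 ≤ R)
    (hN : ∀ x y, ((column Vm Vp x y).card : ℝ) + 1 ≤ N)
    (hA : ((firstCoords Vm Vp).card : ℝ) ≤ A) (hM : ((diagonals Vm Vp).card : ℝ) ≤ M)
    (hdiam : 2 * horizontalDiameter (region Vm Vp) + 1 ≤ R) {V W : State Vm Vp} (hVW : V ≤ W)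
    (n : ℕ) :
    ((alternatingRound Vm Vp t ^ n) *ᵥ volumeIn) W -
        ((alternatingRound Vm Vp t ^ n) *ᵥ volumeIn) V ≤
      M * (((1 - 1 / (2 * R ^ 2)) ^ n * (A * N / R ^ 2) +
        4 * (2 * (A * (N ^ 2 * Real.exp (-(t / N ^ 2)))))) * (2 * R ^ 2)) := by
  set K := (1 - 1 / (2 * R ^ 2)) ^ n * (A * N / R ^ 2) +
    4 * (2 * (A * (N ^ 2 * Real.exp (-(t / N ^ 2))))) with hK
  have hA0 : 0 ≤ A := (Nat.cast_nonneg _).trans hA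
  have hN0 : 0 ≤ N := by
    have := hN 0 0
    linarith [Nat.cast_nonneg (α := ℝ) (column Vm Vp 0 0).card]
  have hR2 : 1 ≤ R ^ 2 := one_le_pow₀ hR
  have hq : 0 ≤ 1 - 1 / (2 * R ^ 2) := by
    rw [sub_nonneg, div_le_one (by positivity)]
    linarith
  have hK0 : 0 ≤ K := by positivity
  -- Any diagonal meeting the region can be the centre, since two of them differ by at most `2 D ≤ R
  -- - 1`.
  obtain ⟨c, hc⟩ : ∃ c : ℝ, ∀ d ∈ diagonals Vm Vp, |(d : ℝ) - c| ≤ R - 1 := by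
    rcases (diagonals Vm Vp).eq_empty_or_nonempty with h | ⟨a, ha⟩
    · exact ⟨0, by simp [h]⟩
    · exact ⟨a, fun d hd => (abs_sub_le_of_mem_diagonals hd ha).trans (by linarith)⟩
  have e1 : volumeIn (Vm := Vm) (Vp := Vp) = ∑ d ∈ diagonals Vm Vp, diagHeight d := by
    funext V
    rw [volumeIn, Finset.sum_apply]
  rw [e1, Matrix.mulVec_sum, Finset.sum_apply, Finset.sum_apply, ← Finset.sum_sub_distrib]
  calc _ ≤ ∑ _d ∈ diagonals Vm Vp, K * (2 * R ^ 2) := by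
        refine Finset.sum_le_sum fun d hd => ?_
        refine (diagGap_alternatingRound_pow_le ht hR hN hA hc hVW n d
          ((hc d hd).trans (by linarith))).trans ?_
        rw [← hK]
        gcongr
        linarith [sq_nonneg ((d : ℝ) - c)]
    _ = (diagonals Vm Vp).card * (K * (2 * R ^ 2)) := by rw [Finset.sum_const, nsmul_eq_mul]
    _ ≤ M * (K * (2 * R ^ 2)) := by gcongr

/-- The true semigroup is cut into `2 n` intervals of length `t`, each compared with a censored one.
A round is a product of two symmetric matrices and need not be symmetric, so `MixesBetter.pow` does
not apply and the factors are peeled off from the left. -/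
theorem mixesBetter_alternatingRound_pow {t : ℝ} (ht : 0 ≤ t) (n : ℕ) :
    MixesBetter (NormedSpace.exp ((2 * n * t) • generator Vm Vp))
      (alternatingRound Vm Vp t ^ n) := by
  classical
  have hL : ∀ e, MixesBetter (NormedSpace.exp (t • generator Vm Vp))
      (NormedSpace.exp (t • parityGenerator Vm Vp e)) := fun e =>
    mixesBetter_exp_flipGenerator isMonotoneFlip_siteUpdate _ ht
  have hS : ∀ e, IsSymmMonotone (NormedSpace.exp (t • parityGenerator Vm Vp e)) := fun e =>
    isSymmMonotone_exp_flipGenerator isMonotoneFlip_siteUpdate _ ht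
  have hexp : NormedSpace.exp ((2 * n * t) • generator Vm Vp) =
      (NormedSpace.exp (t • generator Vm Vp) * NormedSpace.exp (t • generator Vm Vp)) ^ n := by
    rw [← pow_two, ← pow_mul, ← Matrix.exp_nsmul, ← Nat.cast_smul_eq_nsmul ℝ, smul_smul]
    push_cast
    rfl
  rw [hexp]
  clear hexp
  induction n with
  | zero => simpa using MixesBetter.refl (1 : Matrix (State Vm Vp) (State Vm Vp) ℝ)
  | succ n ih =>
    have e : ∀ X Y : Matrix (State Vm Vp) (State Vm Vp) ℝ, (X * Y) ^ (n + 1) = X * (Y * (X * Y) ^ n) :=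
      fun X Y => by rw [pow_succ', mul_assoc]
    have hX : IsSymmMonotone (NormedSpace.exp (t • generator Vm Vp)) :=
      isSymmMonotone_exp_flipGenerator isMonotoneFlip_siteUpdate _ ht
    have hX2 : ∀ f : State Vm Vp → ℝ, Monotone f →
        Monotone ((NormedSpace.exp (t • generator Vm Vp) *
          NormedSpace.exp (t • generator Vm Vp)) ^ n *ᵥ f) := fun f hf => by
      rw [← pow_two, ← pow_mul]
      exact hX.monotone_pow_mulVec _ hf
    rw [alternatingRound, e, e]
    refine (hL 0).mul ((hL 1).mul ih hX2 (hS 1)) (fun f hf => ?_) (hS 0)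
    rw [← Matrix.mulVec_mulVec]
    exact hX.monotone_mulVec _ (hX2 f hf)

/-- The dynamics is close to equilibrium after `n` rounds of two time intervals of length `t`. -/
theorem tvDist_lawAt_le (hVmVp : Vm ≤ Vp) {t : ℝ} (ht : 0 ≤ t) {N R A M : ℝ} (hR : 1 ≤ R)
    (hN : ∀ x y, ((column Vm Vp x y).card : ℝ) + 1 ≤ N)
    (hA : ((firstCoords Vm Vp).card : ℝ) ≤ A) (hM : ((diagonals Vm Vp).card : ℝ) ≤ M)
    (hdiam : 2 * horizontalDiameter (region Vm Vp) + 1 ≤ R) (n : ℕ) (V₀ : State Vm Vp) :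
    tvDist (lawAt Vm Vp (2 * n * t) V₀) (uniformLaw Vm Vp) ≤
      2 * (M * (((1 - 1 / (2 * R ^ 2)) ^ n * (A * N / R ^ 2) +
        4 * (2 * (A * (N ^ 2 * Real.exp (-(t / N ^ 2)))))) * (2 * R ^ 2))) := by
  classical
  set top : State Vm Vp := ⟨Vp, hVmVp, le_rfl⟩ with htop
  set bot : State Vm Vp := ⟨Vm, le_rfl, hVmVp⟩ with hbot
  have hle : bot ≤ top := hVmVp
  have h1 : tvDist (lawAt Vm Vp (2 * n * t) V₀) (uniformLaw Vm Vp) ≤ _ :=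
    tvDist_exp_flipGenerator_le isMonotoneFlip_siteUpdate (by positivity)
      (fun _ _ h => volumeIn_add_one_le h) (bot := bot) (top := top) (fun V => V.2.1)
      (fun V => V.2.2) V₀
  refine h1.trans (mul_le_mul_of_nonneg_left ?_ zero_le_two)
  refine le_trans ?_ (volumeIn_alternatingRound_pow_le ht hR hN hA hM hdiam hle n)
  -- Pairing with this function yields the value at `top` minus the value at `bot`.
  have hF : Monotone (Pi.single top 1 - Pi.single bot 1 : State Vm Vp → ℝ) := by
    have hb : ∀ W : State Vm Vp, W ≤ bot → W = bot := fun W h => le_antisymm h W.2.1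
    have ht : ∀ W : State Vm Vp, top ≤ W → W = top := fun W h => le_antisymm W.2.2 h
    intro V W hVW
    simp only [Pi.sub_apply]
    refine sub_le_sub ?_ ?_
    · by_cases hV : V = top
      · rw [ht W (hV ▸ hVW), hV]
      · rw [Pi.single_eq_of_ne hV]
        exact (Pi.single_nonneg.2 zero_le_one : (0 : State Vm Vp → ℝ) ≤ Pi.single top 1) W
    · by_cases hW : W = bot
      · rw [hb V (hW ▸ hVW), hW]
      · rw [Pi.single_eq_of_ne hW]
        exact (Pi.single_nonneg.2 zero_le_one : (0 : State Vm Vp → ℝ) ≤ Pi.single bot 1) V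
  have hvol : Monotone (volumeIn (Vm := Vm) (Vp := Vp)) := fun V W hVW =>
    Finset.sum_le_sum fun d _ => diagHeight_mono d hVW
  have h2 := mixesBetter_alternatingRound_pow ht n _ _ hF hvol
  simp only [sub_dotProduct, single_dotProduct, one_mul] at h2
  exact h2

end AlternatingDynamics

/-! ### Choice of the constants -/

section Conclusion

theorem half_le_log_of_two_le {a : ℝ} (ha : 2 ≤ a) : 1 / 2 ≤ Real.log a := by
  have h1 := Real.log_le_log (by norm_num) ha
  have h2 := Real.log_two_gt_d9
  linarith

theorem exp_neg_mul_log {a : ℝ} (ha : 0 < a) (k : ℕ) :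
    Real.exp (-(k * Real.log a)) = (a ^ k)⁻¹ := by
  rw [Real.exp_neg, mul_comm, Real.exp_mul, Real.exp_log ha, Real.rpow_natCast]

/-- The prefactors are at most `72 a³` and `15552 a⁶`, using `b ≤ a`, while the decay factors are
`a⁻¹⁵` and `a⁻³⁰`. Already at `a = 2` the total is below `1/6`. -/
theorem error_le_of_large_time {a b : ℝ} (ha : 2 ≤ a) (hb : 1 ≤ b) (hba : b ≤ a) {n : ℕ}
    (hn : 2 * (3 * a) ^ 2 * (15 * Real.log a) ≤ n) :
    2 * (3 * a * (((1 - 1 / (2 * (3 * a) ^ 2)) ^ n * (2 * a * (3 * b) / (3 * a) ^ 2) +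
      4 * (2 * (2 * a * ((3 * b) ^ 2 *
        Real.exp (-((3 * b) ^ 2 * (30 * Real.log a) / (3 * b) ^ 2)))))) * (2 * (3 * a) ^ 2))) ≤
      1 / (2 * Real.exp 1) := by
  have ha0 : 0 < a := by linarith
  have hb0 : 0 < b := by linarith
  have hq1 : 1 / (2 * (3 * a) ^ 2) ≤ 1 := by
    rw [div_le_one (by positivity)]
    nlinarith
  have h1 : (1 - 1 / (2 * (3 * a) ^ 2)) ^ n ≤ (a ^ 15)⁻¹ := by
    calc (1 - 1 / (2 * (3 * a) ^ 2)) ^ n ≤ Real.exp (-(1 / (2 * (3 * a) ^ 2))) ^ n := by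
          refine pow_le_pow_left₀ (by linarith) ?_ n
          linarith [Real.add_one_le_exp (-(1 / (2 * (3 * a) ^ 2)))]
      _ = Real.exp (-(n / (2 * (3 * a) ^ 2))) := by
          rw [← Real.exp_nat_mul]
          congr 1
          ring
      _ ≤ Real.exp (-((15 : ℕ) * Real.log a)) := by
          refine Real.exp_le_exp.2 (neg_le_neg ?_)
          rw [le_div_iff₀ (by positivity)]
          push_cast
          linarith
      _ = (a ^ 15)⁻¹ := exp_neg_mul_log ha0 15
  have h2 : Real.exp (-((3 * b) ^ 2 * (30 * Real.log a) / (3 * b) ^ 2)) = (a ^ 30)⁻¹ := by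
    rw [mul_div_cancel_left₀ _ (by positivity), ← exp_neg_mul_log ha0 30]
    norm_num
  rw [h2]
  have h3 : 2 * (3 * a * (((1 - 1 / (2 * (3 * a) ^ 2)) ^ n * (2 * a * (3 * b) / (3 * a) ^ 2) +
      4 * (2 * (2 * a * ((3 * b) ^ 2 * (a ^ 30)⁻¹)))) * (2 * (3 * a) ^ 2))) ≤
      2 * (3 * a * (((a ^ 15)⁻¹ * (2 * a * (3 * a) / (3 * a) ^ 2) +
      4 * (2 * (2 * a * ((3 * a) ^ 2 * (a ^ 30)⁻¹)))) * (2 * (3 * a) ^ 2))) := by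
    gcongr
  have h4 : 2 * (3 * a * (((a ^ 15)⁻¹ * (2 * a * (3 * a) / (3 * a) ^ 2) +
      4 * (2 * (2 * a * ((3 * a) ^ 2 * (a ^ 30)⁻¹)))) * (2 * (3 * a) ^ 2))) =
      72 * (a ^ 12)⁻¹ + 15552 * (a ^ 24)⁻¹ := by
    field_simp
    ring
  have h5 : (a ^ 12)⁻¹ ≤ (2 ^ 12)⁻¹ := by gcongr
  have h6 : (a ^ 24)⁻¹ ≤ (2 ^ 24)⁻¹ := by gcongr
  have h7 : 1 / 6 ≤ 1 / (2 * Real.exp 1) := by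
    refine one_div_le_one_div_of_le (by positivity) ?_
    linarith [Real.exp_one_lt_d9]
  rw [h4] at h3
  refine h3.trans (le_trans ?_ h7)
  norm_num at h5 h6 ⊢
  linarith

end Conclusion

theorem theorem4p3 :
    ∃ C : ℝ, 0 < C ∧
      ∀ (Vm Vp : PositiveMonotoneSet) [Finite (region Vm Vp)], Vm ≤ Vp →
        ∀ D H : ℝ, D = horizontalDiameter (region Vm Vp) → H = verticalThickness (region Vm Vp) →
          H ≤ D →
            mixingTime Vm Vp ≤
              ENNReal.ofReal (C * (max H 1) ^ 2 * (max D 2) ^ 2 * (Real.log (max D 2)) ^ 2) := by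
  -- The total time is `2 n t` with `t = 270 b² log a` and `n ≤ 270 a² log a + 1 ≤ 272 a² log a`,
  -- because `1 ≤ 2 a² log a`.
  refine ⟨2 * 272 * 270, by norm_num, ?_⟩
  intro Vm Vp _ hVmVp D H hD hH hHD
  set a := max D 2 with ha
  set b := max H 1 with hb
  have ha2 : 2 ≤ a := le_max_right _ _
  have hb1 : 1 ≤ b := le_max_right _ _
  have hDa : D ≤ a := le_max_left _ _
  have hHb : H ≤ b := le_max_left _ _
  have hba : b ≤ a := max_le_max hHD one_le_two
  have hlog := half_le_log_of_two_le ha2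
  have hlog0 : 0 < Real.log a := by linarith
  have hD0 : 0 ≤ D := hD ▸ horizontalDiameter_nonneg _
  set n := ⌈2 * (3 * a) ^ 2 * (15 * Real.log a)⌉₊ with hn
  have hnl : 2 * (3 * a) ^ 2 * (15 * Real.log a) ≤ n := Nat.le_ceil _
  have hnu : (n : ℝ) ≤ 2 * (3 * a) ^ 2 * (15 * Real.log a) + 1 :=
    (Nat.ceil_lt_add_one (by positivity)).le
  have hn0 : (0 : ℝ) < n := lt_of_lt_of_le (by positivity) hnl
  set t := (3 * b) ^ 2 * (30 * Real.log a) with ht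
  have ht0 : 0 < t := by positivity
  have hmem : mixingTime Vm Vp ≤ ENNReal.ofReal (2 * n * t) := by
    refine sInf_le ⟨2 * n * t, by positivity, rfl, fun V₀ => ?_⟩
    -- From `D ≤ a`, `H ≤ b`, `a ≥ 2` and `b ≥ 1`: `H + 2 ≤ 3 b`, `2 D + 1 ≤ 3 a` and `D + 1 ≤ 2 a`.
    refine (tvDist_lawAt_le hVmVp ht0.le (N := 3 * b) (R := 3 * a) (A := 2 * a) (M := 3 * a)
      (by linarith) (fun x y => ?_) ?_ ?_ (by linarith) n V₀).trans
      (error_le_of_large_time ha2 hb1 hba hnl)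
    · linarith [card_column_le (Vm := Vm) (Vp := Vp) x y]
    · linarith [card_firstCoords_le (Vm := Vm) (Vp := Vp)]
    · linarith [card_diagonals_le (Vm := Vm) (Vp := Vp)]
  · refine hmem.trans (ENNReal.ofReal_le_ofReal ?_)
    have h1 : 1 ≤ 2 * (a ^ 2 * Real.log a) := by nlinarith
    have h2 : (n : ℝ) ≤ 272 * (a ^ 2 * Real.log a) := by linarith
    calc 2 * n * t ≤ 2 * (272 * (a ^ 2 * Real.log a)) * t := by gcongr
      _ = 2 * 272 * 270 * b ^ 2 * a ^ 2 * Real.log a ^ 2 := by rw [ht]; ring
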